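/- For a loss $\ell:\mathbb{R}^d\times\mathcal Z\to\mathbb{R}$ and a distribution $\mathcal D$ of $z\in\mathcal Z$, let $L(w)=\mathbb{E}_{z\sim\mathcal D}\,\ell(w;z)$. Consider the following conditions. (A1) For almost every $z\sim\mathcal D$, the function $\ell(\cdot;z)$ is non-negative, convex and $H$-smooth: for all $w,u$, $\ell(u;z)+\langle\nabla\ell(u;z),w-u\rangle\le\ell(w;z)\le\ell(u;z)+\langle\nabla\ell(u;z),w-u\rangle+\frac H2\|w-u\|^2$. (A2) $L$ is convex and has minimum value $L^*$, which is attained at a point $w^*$ with $\|w^*\|\le B$. (A3) $L$ is convex, has (attained) minimum value $L^*$, satisfies $L(0)-L^*\le\Delta$, and $L(w)-L^*\ge\frac\lambda2\min_{w^*\in\operatorname{argmin}L}\|w-w^*\|^2$ for all $w$. An algorithm that uses $T$ minibatch stochastic gradients of size $b$ chooses points $w_1,\dots,w_T\in\mathbb{R}^d$ sequentially. Each $w_t$ may depend on internal randomness and on the stochastic gradients received before. At $w_t$ the algorithm receives $\frac1b\sum_{i=1}^b\nabla\ell(w_t;z_t^i)$, where all the $z_t^i\sim\mathcal D$ are independent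 of each other and of the internal randomness. After $T$ steps it outputs a point $\hat w$ that depends on the internal randomness and on the $T$ stochastic gradients received. Convex case. There is a universal constant $c>0$ such that for all $H,B>0$, all integers $T,b\ge1$ and all $0\le L^*\le HB^2\,bT$ there are a dimension $d$ and a loss $\ell(w;z)$ on $\mathbb{R}^d$ such that, for every algorithm that uses $T$ minibatch stochastic gradients of size $b$, there is a distribution of $z$ for which (A1) and (A2) hold and $$\mathbb{E}L(\hat w)-L^*\ \ge\ c\left(\frac{HB^2}{T^2}+\frac{HB^2}{bT}+\sqrt{\frac{HB^2L^*}{bT}}\right).$$ Strongly convex case. There are universal constants $c,c'>0$ such that for all $\Delta>0$, all $\lambda>0$ and $H\ge2\lambda$, all integers $T,b\ge1$ and all $L^*\ge0$ there are a dimension $d$ and a loss $\ell(w;z)$ on $\mathbb{R}^d$ such that, for every algorithm that uses $T$ minibatch stochastic gradients of size $b$, there is a distribution of $z$ for which (A1) and (A3) hold, $L$ is $\lambda$-strongly convex, and $$\mathbb{E}L(\hat w)-L^*\ \ge\ c\left(\Delta\exp\left(-c'\,\frac{\sqrt\lambda\,T}{\sqrt H}\right)+\Delta\cdot\mathbf 1\!\left[bT\le\frac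 H{2\lambda}\right]+\min\left\{\frac{HL^*}{\lambda bT},\,\Delta\right\}\right).$$ -/

import Mathlib

open MeasureTheory
open scoped ENNReal

noncomputable section

namespace MinibatchLB

/-- The space of parameters `ℝ^d` with its Euclidean norm. -/
abbrev E (d : ℕ) := EuclideanSpace ℝ (Fin d)

/-- The gradient `∇ ℓ(w; z)` with respect to the parameter `w`. -/
def lossGrad {d : ℕ} {Z : Type} (l : E d → Z → ℝ) (w : E d) (z : Z) : E d :=
  gradient (fun u => l u z) w

/-- The loss and its gradient are jointly measurable, so that stochastic gradients
at random points are random variables. -/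
def MeasurableLoss {d : ℕ} {Z : Type} [MeasurableSpace Z] (l : E d → Z → ℝ) : Prop :=
  Measurable (fun p : E d × Z => l p.1 p.2) ∧
  Measurable (fun p : E d × Z => lossGrad l p.1 p.2)

/-- The expected loss `L(w) = 𝔼_{z ∼ D} ℓ(w; z)`. -/
def expLoss {d : ℕ} {Z : Type} [MeasurableSpace Z] (l : E d → Z → ℝ) (D : Measure Z)
    (w : E d) : ℝ :=
  ∫ z, l w z ∂D

/-- For almost every `z ∼ D`, the function `ℓ(·; z)` is non-negative, convex and `H`-smooth.
Convexity is the first-order lower bound. -/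
def SmoothConvexLoss {d : ℕ} {Z : Type} [MeasurableSpace Z] (l : E d → Z → ℝ)
    (D : Measure Z) (H : ℝ) : Prop :=
  ∀ᵐ z ∂D,
    Differentiable ℝ (fun w => l w z) ∧
    (∀ w, 0 ≤ l w z) ∧
    ∀ w u : E d,
      l u z + inner ℝ (lossGrad l u z) (w - u) ≤ l w z ∧
      l w z ≤ l u z + inner ℝ (lossGrad l u z) (w - u) + H / 2 * ‖w - u‖ ^ 2

/-- `L` is convex and has minimum value `Lstar`, attained at a point of norm at most `B`. -/
def ConvexAssumption {d : ℕ} (L : E d → ℝ) (Lstar B : ℝ) : Prop :=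
  ConvexOn ℝ Set.univ L ∧
  (∀ w, Lstar ≤ L w) ∧
  ∃ wstar : E d, ‖wstar‖ ≤ B ∧ L wstar = Lstar

/-- The set of minimizers of `L`. -/
def argminSet {d : ℕ} (L : E d → ℝ) : Set (E d) := {u | ∀ v, L u ≤ L v}

/-- `L` is convex, has (attained) minimum value `Lstar`, satisfies `L(0) - Lstar ≤ Δ`, and grows
at least like `lam / 2` times the squared distance to its set of minimizers. That set is closed
and non-empty, so that the distance is a minimum. -/
def GrowthAssumption {d : ℕ} (L : E d → ℝ) (Lstar Δ lam : ℝ) : Prop :=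
  ConvexOn ℝ Set.univ L ∧
  (∀ w, Lstar ≤ L w) ∧
  (∃ wstar : E d, L wstar = Lstar) ∧
  L 0 - Lstar ≤ Δ ∧
  ∀ w, lam / 2 * Metric.infDist w (argminSet L) ^ 2 ≤ L w - Lstar

/-- The minibatch stochastic gradient `(1/b) ∑ᵢ ∇ ℓ(w; zᵢ)`. -/
def minibatchGrad {d b : ℕ} {Z : Type} (l : E d → Z → ℝ) (w : E d) (z : Fin b → Z) : E d :=
  (1 / (b : ℝ)) • ∑ i, lossGrad l w (z i)

/-- An arbitrary, possibly randomized, algorithm that uses `T` stochastic gradients. Its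
internal randomness is a seed in `Ω`. The query point number `t` (counted from `0`) is a
measurable function of the seed and of the `t` stochastic gradients received before, and the
output is a measurable function of the seed and of all `T` stochastic gradients. Only the maps
`query t` with `t < T` are ever used. -/
structure Algorithm (d T : ℕ) (Ω : Type) [MeasurableSpace Ω] where
  query : ∀ t : ℕ, Ω → (Fin t → E d) → E d
  output : Ω → (Fin T → E d) → E d
  measurable_query : ∀ t, Measurable (fun p : Ω × (Fin t → E d) => query t p.1 p.2)
  measurable_output : Measurable (fun p : Ω × (Fin T → E d) => output p.1 p.2)

/-- The first `t` minibatch stochastic gradients that the algorithm receives, when its seed is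
`ω` and the minibatches are `z 0, …, z (t - 1)`. -/
def Algorithm.transcript {d T b : ℕ} {Ω Z : Type} [MeasurableSpace Ω]
    (A : Algorithm d T Ω) (l : E d → Z → ℝ) (ω : Ω) :
    ∀ t : ℕ, (Fin t → Fin b → Z) → Fin t → E d
  | 0, _ => fun i => i.elim0
  | t + 1, z =>
    Fin.snoc (α := fun _ => E d) (A.transcript l ω t (fun i => z i.castSucc))
      (minibatchGrad l (A.query t ω (A.transcript l ω t (fun i => z i.castSucc)))
        (z (Fin.last t)))

/-- The output of the algorithm with seed `ω` and minibatches `z 0, …, z (T - 1)`. -/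
def Algorithm.run {d T b : ℕ} {Ω Z : Type} [MeasurableSpace Ω]
    (A : Algorithm d T Ω) (l : E d → Z → ℝ) (ω : Ω) (z : Fin T → Fin b → Z) : E d :=
  A.output ω (A.transcript l ω T z)

/-- The expected error `𝔼 L(ŵ) - Lstar` of the output, over the seed and over `T` independent
minibatches of `b` independent samples from `D`. It is an integral with values in `[0, ∞]`, as
an algorithm may have infinite expected error. -/
def Algorithm.expectedError {d T : ℕ} {Ω Z : Type} [MeasurableSpace Ω] [MeasurableSpace Z]
    (A : Algorithm d T Ω) (P : Measure Ω) (b : ℕ) (l : E d → Z → ℝ) (D : Measure Z)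
    (Lstar : ℝ) : ℝ≥0∞ :=
  ∫⁻ p : Ω × (Fin T → Fin b → Z), ENNReal.ofReal (expLoss l D (A.run l p.1 p.2) - Lstar)
    ∂(P.prod (Measure.pi fun _ : Fin T => Measure.pi fun _ : Fin b => D))

end MinibatchLB

end

/-! Each right-hand side is a sum of at most three terms, so it suffices to produce, for whichever
term dominates, an instance whose error is at least a constant times that term. Two families suffice
for both cases, because a strongly convex instance is also a convex one (`HardInstance`). In both,
the loss is fixed before the algorithm and only the distribution is chosen against it.

Statistical terms (`hardInstance_twoPoint`): on the line, a sample is uninformative with probability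
1 - p and otherwise pulls towards A or -A with a bias ε of unknown sign. If p ε² bT ≤ 1/2, the
Hellinger affinity of the two laws of all bT samples is at least 1/2, so the laws share a constant
mass. On that mass one output has to serve two different minimizers. This is Le Cam's method. The
variance of the pulls supplies the value of L*. The choice ε = 1 has no variance and covers the
terms without L*.

Optimization terms (`hardInstance_chain`, `hardInstance_exp`): the distribution is a point mass, so
minibatches give exact gradients and b is irrelevant. The loss is a Moreau envelope of a chain of
hinges, plus λ/2 ‖w‖². The chain runs through N > T slots, one at a random place in each of N large
blocks of coordinates. A gradient reveals only the proximal point, which is confined to a ball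
whatever the query is. A bounded vector computed without knowing a slot is almost surely small there
when the block is large (`two_mul_card_large_slot_le`). While later slots stay hidden, their links
stay inactive, so each query discovers one slot at most (`prox_chain_eq`). After T queries the
output is nearly zero in the last N - T slots, where the minimizer is not. With minimizer
coordinates that decay geometrically at rate 1 - s, s of order √(λ/H), this costs Δ exp(-c' T
√(λ/H)). The convex term HB²/T² is the case λ = H/(2T²). -/

noncomputable section

namespace MinibatchLB


/-! ### Two-sided quadratic bounds and their consequences -/

section FirstOrder

variable {V : Type*} [NormedAddCommGroup V] [InnerProductSpace ℝ V]

/-- `f` lies between two quadratics with curvatures `m` and `H` that are tangent to it,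
with `g` in the role of its gradient. -/
def QuadBounds (f : V → ℝ) (g : V → V) (m H : ℝ) : Prop :=
  ∀ w u : V, f u + inner ℝ (g u) (w - u) + m / 2 * ‖w - u‖ ^ 2 ≤ f w ∧
    f w ≤ f u + inner ℝ (g u) (w - u) + H / 2 * ‖w - u‖ ^ 2

/-- The two quadratics squeeze the first-order remainder to O(‖w - u‖²), so `g` is forced to be the
gradient. Differentiability of envelopes comes from here. -/
theorem QuadBounds.hasGradientAt [CompleteSpace V] {f : V → ℝ} {g : V → V} {m H : ℝ}
    (h : QuadBounds f g m H) (u : V) : HasGradientAt f (g u) u := by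
  rw [hasGradientAt_iff_isLittleO]
  have hO : (fun w => f w - f u - inner ℝ (g u) (w - u)) =O[nhds u]
      fun w => ‖w - u‖ ^ 2 := by
    refine Asymptotics.IsBigO.of_bound (|m / 2| + |H / 2|) (Filter.Eventually.of_forall ?_)
    intro w
    obtain ⟨h1, h2⟩ := h w u
    have hn : 0 ≤ ‖w - u‖ ^ 2 := by positivity
    rw [Real.norm_eq_abs, Real.norm_eq_abs, abs_of_nonneg hn, abs_le]
    have e1 := mul_le_mul_of_nonneg_right (neg_abs_le (m / 2)) hn
    have e2 := mul_le_mul_of_nonneg_right (le_abs_self (H / 2)) hn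
    have e3 := mul_nonneg (abs_nonneg (m / 2)) hn
    have e4 := mul_nonneg (abs_nonneg (H / 2)) hn
    constructor <;> nlinarith
  refine hO.trans_isLittleO ?_
  have h0 : Filter.Tendsto (fun w : V => w - u) (nhds u) (nhds 0) := by
    have : Continuous (fun w : V => w - u) := by fun_prop
    simpa using this.tendsto u
  have := (Asymptotics.isLittleO_norm_pow_id (E' := V) one_lt_two).comp_tendsto h0
  simpa [Function.comp_def] using this

/-- Take the lower bounds tangent at z = ax + by, evaluated at x and y, with weights a and b: the
linear terms cancel and ab² + ba² = ab. -/
theorem QuadBounds.strongConvexOn {f : V → ℝ} {g : V → V} {m H : ℝ}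
    (h : QuadBounds f g m H) : StrongConvexOn Set.univ m f := by
  refine ⟨convex_univ, ?_⟩
  intro x _ y _ a b ha hb hab
  set z := a • x + b • y with hz
  have h1 := (h x z).1
  have h2 := (h y z).1
  have ex : x - z = b • (x - y) := by
    rw [hz, show a = 1 - b by linarith]; module
  have ey : y - z = (-a) • (x - y) := by
    rw [hz, show b = 1 - a by linarith]; module
  rw [ex, inner_smul_right, norm_smul, mul_pow] at h1
  rw [ey, inner_smul_right, norm_smul, mul_pow] at h2
  simp only [Real.norm_eq_abs, sq_abs, neg_sq] at h1 h2
  have h1' := mul_le_mul_of_nonneg_left h1 ha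
  have h2' := mul_le_mul_of_nonneg_left h2 hb
  simp only [smul_eq_mul]
  have hb' : b = 1 - a := by linarith
  subst hb'
  nlinarith

theorem convexOn_of_strongConvexOn {f : V → ℝ} {m : ℝ} (hm : 0 ≤ m)
    (h : StrongConvexOn Set.univ m f) : ConvexOn ℝ Set.univ f := by
  refine ⟨convex_univ, ?_⟩
  intro x hx y hy a b ha hb hab
  have := h.2 hx hy ha hb hab
  have h2 : 0 ≤ a * b * (m / 2 * ‖x - y‖ ^ 2) := by positivity
  linarith

theorem QuadBounds.add_const {f : V → ℝ} {g : V → V} {m H : ℝ} (h : QuadBounds f g m H) (c : ℝ) :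
    QuadBounds (fun w => f w + c) g m H := by
  intro w u
  obtain ⟨h1, h2⟩ := h w u
  constructor <;> simp only <;> linarith

theorem QuadBounds.mono {f : V → ℝ} {g : V → V} {m H m' H' : ℝ} (h : QuadBounds f g m H)
    (hm : m' ≤ m) (hH : H ≤ H') : QuadBounds f g m' H' := by
  intro w u
  obtain ⟨h1, h2⟩ := h w u
  have hn : 0 ≤ ‖w - u‖ ^ 2 := by positivity
  constructor <;> nlinarith

theorem quadBounds_quadratic (κ : ℝ) (x : V) :
    QuadBounds (fun w => κ / 2 * ‖w - x‖ ^ 2) (fun w => κ • (w - x)) κ κ := by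
  intro w u
  have e : ‖w - x‖ ^ 2 = ‖u - x‖ ^ 2 + 2 * inner ℝ (u - x) (w - u) + ‖w - u‖ ^ 2 := by
    rw [← norm_add_sq_real]; congr 2; abel
  simp only [inner_smul_left, e]
  constructor <;> simp <;> linarith

theorem QuadBounds.add {f f' : V → ℝ} {g g' : V → V} {m H m' H' : ℝ} (h : QuadBounds f g m H)
    (h' : QuadBounds f' g' m' H') :
    QuadBounds (fun w => f w + f' w) (fun w => g w + g' w) (m + m') (H + H') := by
  intro w u
  obtain ⟨h1, h2⟩ := h w u
  obtain ⟨h3, h4⟩ := h' w u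
  simp only [inner_add_left]
  constructor <;> linarith

end FirstOrder

/-! ### Hard instances and their use in both cases -/

theorem growthAssumption_of_quadratic_growth {d : ℕ} {L : E d → ℝ} {Lstar Δ lam : ℝ}
    (hlam : 0 ≤ lam) (hL : ConvexOn ℝ Set.univ L) (u : E d) (hu : L u = Lstar)
    (hg : ∀ w, L u + lam / 2 * ‖w - u‖ ^ 2 ≤ L w) (h0 : L 0 - Lstar ≤ Δ) :
    GrowthAssumption L Lstar Δ lam := by
  have hmin : ∀ w, L u ≤ L w := fun w => by
    have := hg w
    have : 0 ≤ lam / 2 * ‖w - u‖ ^ 2 := by positivity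
    linarith
  refine ⟨hL, fun w => hu ▸ hmin w, ⟨u, hu⟩, h0, fun w => ?_⟩
  have hmem : u ∈ argminSet L := hmin
  have h1 : Metric.infDist w (argminSet L) ≤ ‖w - u‖ := by
    rw [← dist_eq_norm]; exact Metric.infDist_le_dist_of_mem hmem
  have h2 : Metric.infDist w (argminSet L) ^ 2 ≤ ‖w - u‖ ^ 2 :=
    pow_le_pow_left₀ Metric.infDist_nonneg h1 2
  have := mul_le_mul_of_nonneg_left h2 (by positivity : 0 ≤ lam / 2)
  linarith [hg w]

theorem smoothConvexLoss_of_quadBounds {d : ℕ} {Z : Type} [MeasurableSpace Z] {l : E d → Z → ℝ}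
    {D : Measure Z} {H : ℝ}
    (h : ∀ᵐ z ∂D, (∀ w, 0 ≤ l w z) ∧ ∃ g, QuadBounds (fun w => l w z) g 0 H) :
    SmoothConvexLoss l D H := by
  filter_upwards [h] with z ⟨hz, g, hg⟩
  refine ⟨fun w => (hg.hasGradientAt w).differentiableAt, hz, fun w u => ?_⟩
  have := hg w u
  rw [lossGrad, (hg.hasGradientAt u).gradient]
  simpa using this

/-- A loss on which every algorithm with `T` minibatch gradients of size `b` has expected error at
least `err` for some distribution: the expected loss is `lam`-strongly convex with minimum
`Lstar`, attained in the ball of radius `r`, and exceeds it by at most `Δ` at the origin. -/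
def HardInstance (H lam Lstar Δ r err : ℝ) (T b : ℕ) : Prop :=
  ∃ (d : ℕ) (Z : Type) (_ : MeasurableSpace Z) (l : E d → Z → ℝ),
    MeasurableLoss l ∧
    ∀ (Ω : Type) [MeasurableSpace Ω] (P : Measure Ω) [IsProbabilityMeasure P]
      (A : Algorithm d T Ω),
      ∃ D : Measure Z, IsProbabilityMeasure D ∧
        (∀ w, Integrable (l w) D) ∧
        SmoothConvexLoss l D H ∧
        (∃ g u, QuadBounds (expLoss l D) g lam H ∧ g u = 0 ∧ expLoss l D u = Lstar ∧ ‖u‖ ≤ r ∧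
          expLoss l D 0 - Lstar ≤ Δ) ∧
        ENNReal.ofReal err ≤ A.expectedError P b l D Lstar

theorem HardInstance.convex {H lam Lstar Δ r err : ℝ} {T b : ℕ}
    (h : HardInstance H lam Lstar Δ r err T b) (hlam : 0 ≤ lam) {B err' : ℝ} (hB : r ≤ B)
    (herr : err' ≤ err) :
    ∃ (d : ℕ) (Z : Type) (_ : MeasurableSpace Z) (l : E d → Z → ℝ),
      MeasurableLoss l ∧
      ∀ (Ω : Type) [MeasurableSpace Ω] (P : Measure Ω) [IsProbabilityMeasure P]
        (A : Algorithm d T Ω),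
        ∃ D : Measure Z, IsProbabilityMeasure D ∧
          (∀ w, Integrable (l w) D) ∧
          SmoothConvexLoss l D H ∧
          ConvexAssumption (expLoss l D) Lstar B ∧
          ENNReal.ofReal err' ≤ A.expectedError P b l D Lstar := by
  obtain ⟨d, Z, mZ, l, hl, h⟩ := h
  refine ⟨d, Z, mZ, l, hl, fun Ω _ P _ A => ?_⟩
  obtain ⟨D, hD, hint, hsm, ⟨g, u, hq, hgu, hu, hur, -⟩, he⟩ := h Ω P A
  refine ⟨D, hD, hint, hsm, ⟨convexOn_of_strongConvexOn hlam hq.strongConvexOn, fun w => ?_,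
    u, hur.trans hB, hu⟩, (ENNReal.ofReal_le_ofReal herr).trans he⟩
  have := (hq w u).1
  rw [hgu, inner_zero_left, hu] at this
  have : 0 ≤ lam / 2 * ‖w - u‖ ^ 2 := by positivity
  linarith

theorem HardInstance.stronglyConvex {H lam Lstar Δ r err : ℝ} {T b : ℕ}
    (h : HardInstance H lam Lstar Δ r err T b) (hlam : 0 ≤ lam) {Δ' err' : ℝ} (hΔ : Δ ≤ Δ')
    (herr : err' ≤ err) :
    ∃ (d : ℕ) (Z : Type) (_ : MeasurableSpace Z) (l : E d → Z → ℝ),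
      MeasurableLoss l ∧
      ∀ (Ω : Type) [MeasurableSpace Ω] (P : Measure Ω) [IsProbabilityMeasure P]
        (A : Algorithm d T Ω),
        ∃ D : Measure Z, IsProbabilityMeasure D ∧
          (∀ w, Integrable (l w) D) ∧
          SmoothConvexLoss l D H ∧
          GrowthAssumption (expLoss l D) Lstar Δ' lam ∧
          StrongConvexOn Set.univ lam (expLoss l D) ∧
          ENNReal.ofReal err' ≤ A.expectedError P b l D Lstar := by
  obtain ⟨d, Z, mZ, l, hl, h⟩ := h
  refine ⟨d, Z, mZ, l, hl, fun Ω _ P _ A => ?_⟩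
  obtain ⟨D, hD, hint, hsm, ⟨g, u, hq, hgu, hu, -, hu0⟩, he⟩ := h Ω P A
  refine ⟨D, hD, hint, hsm, ?_, hq.strongConvexOn, (ENNReal.ofReal_le_ofReal herr).trans he⟩
  refine growthAssumption_of_quadratic_growth hlam
    (convexOn_of_strongConvexOn hlam hq.strongConvexOn) u hu (fun w => ?_) (hu0.trans hΔ)
  have := (hq w u).1
  rwa [hgu, inner_zero_left, add_zero] at this

/-! ### Measurability of losses and runs -/

section Measurability

variable {d : ℕ} {Z : Type}

theorem measurable_gradient {d : ℕ} (f : E d → ℝ) : Measurable (gradient f) :=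
  ((InnerProductSpace.toDual ℝ (E d)).symm.continuous.measurable).comp (measurable_fderiv ℝ f)

/-- Over countably many samples, joint measurability reduces to one statement per sample, and the
gradient of an arbitrary function is measurable. -/
theorem measurableLoss_of_countable [Countable Z] [MeasurableSpace Z] [MeasurableSingletonClass Z]
    {l : E d → Z → ℝ} (h : ∀ z, Measurable (fun w => l w z)) : MeasurableLoss l :=
  ⟨measurable_from_prod_countable_left h,
    measurable_from_prod_countable_left fun z => measurable_gradient (fun w => l w z)⟩

variable {T b : ℕ} {Ω : Type} [MeasurableSpace Ω]

theorem Algorithm.measurable_transcript (A : Algorithm d T Ω) {l : E d → Z → ℝ}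
    (t : ℕ) (z : Fin t → Fin b → Z) : Measurable (fun ω => A.transcript l ω t z) := by
  induction t with
  | zero => exact measurable_pi_iff.2 fun i => i.elim0
  | succ t ih =>
    have h := ih (fun i => z i.castSucc)
    refine measurable_pi_iff.2 fun i => ?_
    refine Fin.lastCases ?_ (fun j => ?_) i
    · simp only [Algorithm.transcript, Fin.snoc_last, minibatchGrad]
      have hq : Measurable fun ω => A.query t ω (A.transcript l ω t (fun i => z i.castSucc)) :=
        (A.measurable_query t).comp (measurable_id.prodMk h)
      have hs : Measurable fun ω => ∑ i, lossGrad l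
          (A.query t ω (A.transcript l ω t (fun i => z i.castSucc))) (z (Fin.last t) i) :=
        Finset.measurable_fun_sum _ fun i _ =>
          (measurable_gradient (fun u => l u (z (Fin.last t) i))).comp hq
      exact hs.const_smul (1 / (b : ℝ))
    · simp only [Algorithm.transcript, Fin.snoc_castSucc]
      exact (measurable_pi_iff.1 h) j

theorem Algorithm.measurable_run (A : Algorithm d T Ω) {l : E d → Z → ℝ}
    (z : Fin T → Fin b → Z) : Measurable (fun ω => A.run l ω z) :=
  A.measurable_output.comp (measurable_id.prodMk (A.measurable_transcript T z))

/-- Over a finite sample space, the expected error is a weighted sum over the samples. -/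
theorem Algorithm.expectedError_eq_sum [Fintype Z] [MeasurableSpace Z] [MeasurableSingletonClass Z]
    (A : Algorithm d T Ω) (P : Measure Ω) [IsProbabilityMeasure P] (l : E d → Z → ℝ)
    (D : Measure Z) [IsProbabilityMeasure D] (Lstar : ℝ) (hL : Measurable (expLoss l D)) :
    A.expectedError P b l D Lstar =
      ∑ z : Fin T → Fin b → Z, (∫⁻ ω, ENNReal.ofReal (expLoss l D (A.run l ω z) - Lstar) ∂P) *
        ∏ t, ∏ i, D {z t i} := by
  have hm : Measurable fun p : Ω × (Fin T → Fin b → Z) =>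
      ENNReal.ofReal (expLoss l D (A.run l p.1 p.2) - Lstar) := by
    refine measurable_from_prod_countable_left fun z => ?_
    exact ((hL.comp (A.measurable_run z)).sub_const _).ennreal_ofReal
  rw [Algorithm.expectedError, lintegral_prod_symm _ hm.aemeasurable, lintegral_fintype]
  simp only [Measure.pi_singleton]

end Measurability


/-! ### Finite sample spaces and Le Cam's two-point method -/

section WeightMeasure

variable {Z : Type} [Fintype Z] [MeasurableSpace Z]

/-- The measure with masses `ρ z` at the points `z` of a finite type. -/
def weightMeasure (ρ : Z → ℝ) : Measure Z := ∑ z, ENNReal.ofReal (ρ z) • Measure.dirac z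

theorem weightMeasure_singleton [MeasurableSingletonClass Z] (ρ : Z → ℝ) (z : Z) :
    weightMeasure ρ {z} = ENNReal.ofReal (ρ z) := by
  classical
  simp [weightMeasure, Measure.finsetSum_apply, Set.indicator_apply]

theorem isProbabilityMeasure_weightMeasure {ρ : Z → ℝ} (h0 : ∀ z, 0 ≤ ρ z) (h1 : ∑ z, ρ z = 1) :
    IsProbabilityMeasure (weightMeasure ρ) := by
  constructor
  simp only [weightMeasure, Measure.finsetSum_apply, Measure.smul_apply, measure_univ,
    smul_eq_mul, mul_one]
  rw [← ENNReal.ofReal_sum_of_nonneg fun z _ => h0 z, h1, ENNReal.ofReal_one]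

theorem expLoss_weightMeasure [MeasurableSingletonClass Z] {d : ℕ} {ρ : Z → ℝ}
    (h0 : ∀ z, 0 ≤ ρ z) (h1 : ∑ z, ρ z = 1)
    (l : E d → Z → ℝ) (w : E d) : expLoss l (weightMeasure ρ) w = ∑ z, ρ z * l w z := by
  have := isProbabilityMeasure_weightMeasure h0 h1
  rw [expLoss, integral_fintype Integrable.of_finite]
  simp [measureReal_def, weightMeasure_singleton, ENNReal.toReal_ofReal (h0 _)]

end WeightMeasure

/-- Independence. Used with `r` a probability vector, for total mass 1, and with `r` the square root
of a product of two such vectors, for the affinity of bT samples. -/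
theorem sum_prod_prod_eq_pow {Z : Type} [Fintype Z] (r : Z → ℝ) (T b : ℕ) :
    ∑ z : Fin T → Fin b → Z, ∏ t, ∏ i, r (z t i) = (∑ z, r z) ^ (b * T) := by
  classical
  have h (ι : Type) [Fintype ι] [DecidableEq ι] (X : Type) [Fintype X] (f : X → ℝ) :
      ∑ z : ι → X, ∏ i, f (z i) = (∑ x, f x) ^ Fintype.card ι := by
    rw [← Finset.card_univ, ← Finset.prod_const, Finset.prod_univ_sum, Fintype.piFinset_univ]
  rw [h (Fin T) (Fin b → Z) (fun x => ∏ i, r (x i)), h (Fin b) Z r]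
  simp [pow_mul]

/-- If the Hellinger affinity of two probability vectors is at least `1/2`, they share a mass of
at least `1/8`. -/
theorem one_div_eight_le_sum_min {X : Type} [Fintype X] {f g r : X → ℝ} (hf : ∀ x, 0 ≤ f x)
    (hg : ∀ x, 0 ≤ g x) (hf1 : ∑ x, f x = 1) (hg1 : ∑ x, g x = 1)
    (hr : ∀ x, r x ^ 2 = f x * g x) (hrs : 1 / 2 ≤ ∑ x, r x) :
    1 / 8 ≤ ∑ x, min (f x) (g x) := by
  -- Cauchy–Schwarz with r² = f g = min · max; as the maxima sum to at most 2, this gives 1/4 ≤ 2 ∑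
  -- min.
  have h := Finset.sum_sq_le_sum_mul_sum_of_sq_le_mul Finset.univ (r := r)
    (f := fun x => min (f x) (g x)) (g := fun x => max (f x) (g x))
    (fun x _ => le_min (hf x) (hg x)) (fun x _ => (hf x).trans (le_max_left _ _))
    (fun x _ => by rw [hr, min_mul_max])
  have hmax : ∑ x, max (f x) (g x) ≤ 2 := by
    calc ∑ x, max (f x) (g x) ≤ ∑ x, (f x + g x) := Finset.sum_le_sum fun x _ =>
          max_le (by linarith [hg x]) (by linarith [hf x])
      _ = 2 := by rw [Finset.sum_add_distrib, hf1, hg1]; norm_num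
  have hmin : 0 ≤ ∑ x, min (f x) (g x) :=
    Finset.sum_nonneg fun x _ => le_min (hf x) (hg x)
  nlinarith

/-- Two sample distributions that an algorithm cannot tell apart, and for which no point is good
for both: on one of them the expected error is large. -/
theorem le_expectedError_of_affinity {d T b : ℕ} {Ω Z : Type} [MeasurableSpace Ω] [Fintype Z]
    [MeasurableSpace Z] [MeasurableSingletonClass Z] (A : Algorithm d T Ω) (P : Measure Ω)
    [IsProbabilityMeasure P] {l : E d → Z → ℝ} (hl : ∀ z, Measurable fun w => l w z)
    {ρ : Bool → Z → ℝ} (h0 : ∀ s z, 0 ≤ ρ s z) (h1 : ∀ s, ∑ z, ρ s z = 1)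
    (haff : 1 / 2 ≤ (∑ z, √(ρ true z * ρ false z)) ^ (b * T)) {η Lstar : ℝ} (hη : 0 ≤ η)
    (hsep : ∀ w, η ≤ (∑ z, ρ true z * l w z - Lstar) + (∑ z, ρ false z * l w z - Lstar)) :
    ∃ s, ENNReal.ofReal (η / 16) ≤ A.expectedError P b l (weightMeasure (ρ s)) Lstar := by
  have hp := fun s => isProbabilityMeasure_weightMeasure (h0 s) (h1 s)
  have hL : ∀ s, expLoss l (weightMeasure (ρ s)) = fun w => ∑ z, ρ s z * l w z := fun s =>
    funext fun w => expLoss_weightMeasure (h0 s) (h1 s) l w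
  have hLm : ∀ s, Measurable fun w => ∑ z, ρ s z * l w z := fun s =>
    Finset.measurable_fun_sum _ fun z _ => (hl z).const_mul _
  set W : Bool → (Fin T → Fin b → Z) → ℝ := fun s z => ∏ t, ∏ i, ρ s (z t i) with hW
  have hW0 : ∀ s z, 0 ≤ W s z := fun s z =>
    Finset.prod_nonneg fun t _ => Finset.prod_nonneg fun i _ => h0 s _
  set I : Bool → (Fin T → Fin b → Z) → ℝ≥0∞ := fun s z =>
    ∫⁻ ω, ENNReal.ofReal (∑ z', ρ s z' * l (A.run l ω z) z' - Lstar) ∂P with hI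
  have herr : ∀ s, A.expectedError P b l (weightMeasure (ρ s)) Lstar =
      ∑ z, I s z * ENNReal.ofReal (W s z) := by
    intro s
    have hLs : Measurable (expLoss l (weightMeasure (ρ s))) := by rw [hL s]; exact hLm s
    rw [A.expectedError_eq_sum P l _ Lstar hLs]
    refine Finset.sum_congr rfl fun z _ => ?_
    rw [hL s]
    congr 1
    simp only [weightMeasure_singleton, hW]
    rw [ENNReal.ofReal_prod_of_nonneg fun t _ => Finset.prod_nonneg fun i _ => h0 s _]
    refine Finset.prod_congr rfl fun t _ => ?_
    rw [ENNReal.ofReal_prod_of_nonneg fun i _ => h0 s _]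
  -- For a fixed seed and fixed samples the run does not depend on the sign, so `hsep` applies to
  -- one common output.
  have hIsum : ∀ z, ENNReal.ofReal η ≤ I true z + I false z := by
    intro z
    have hmeas : ∀ s, Measurable fun ω =>
        ENNReal.ofReal (∑ z', ρ s z' * l (A.run l ω z) z' - Lstar) := fun s =>
      (((hLm s).comp (A.measurable_run z)).sub_const _).ennreal_ofReal
    rw [hI]
    simp only
    rw [← lintegral_add_left (hmeas true)]
    calc ENNReal.ofReal η = ∫⁻ _, ENNReal.ofReal η ∂P := by simp
      _ ≤ _ := lintegral_mono fun ω =>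
        (ENNReal.ofReal_le_ofReal (hsep _)).trans ENNReal.ofReal_add_le
  have hmin : 1 / 8 ≤ ∑ z, min (W true z) (W false z) := by
    refine one_div_eight_le_sum_min (r := fun z => ∏ t, ∏ i, √(ρ true (z t i) * ρ false (z t i)))
      (hW0 true) (hW0 false) ?_ ?_ ?_ ?_
    · rw [hW]; simp only; rw [sum_prod_prod_eq_pow, h1, one_pow]
    · rw [hW]; simp only; rw [sum_prod_prod_eq_pow, h1, one_pow]
    · intro z
      simp only [hW, ← Finset.prod_pow, ← Finset.prod_mul_distrib]
      refine Finset.prod_congr rfl fun t _ => Finset.prod_congr rfl fun i _ => ?_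
      rw [Real.sq_sqrt (mul_nonneg (h0 _ _) (h0 _ _))]
    · rw [sum_prod_prod_eq_pow (fun z => √(ρ true z * ρ false z))]; exact haff
  have hmin0 : ∀ z, 0 ≤ min (W true z) (W false z) := fun z => le_min (hW0 _ _) (hW0 _ _)
  have htotal : ENNReal.ofReal (η / 8) ≤ A.expectedError P b l (weightMeasure (ρ true)) Lstar +
      A.expectedError P b l (weightMeasure (ρ false)) Lstar := by
    rw [herr, herr, ← Finset.sum_add_distrib]
    calc ENNReal.ofReal (η / 8)
        ≤ ENNReal.ofReal (∑ z, η * min (W true z) (W false z)) := by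
          refine ENNReal.ofReal_le_ofReal ?_
          rw [← Finset.mul_sum]
          nlinarith
      _ = ∑ z, ENNReal.ofReal η * ENNReal.ofReal (min (W true z) (W false z)) := by
          rw [ENNReal.ofReal_sum_of_nonneg fun z _ => mul_nonneg hη (hmin0 z)]
          simp only [ENNReal.ofReal_mul hη]
      _ ≤ _ := by
          refine Finset.sum_le_sum fun z _ => ?_
          refine (mul_le_mul_left (hIsum z) _).trans ?_
          rw [add_mul]
          gcongr
          · exact min_le_left _ _
          · exact min_le_right _ _
  by_contra hcon
  push Not at hcon
  have h2 := ENNReal.add_lt_add (hcon true) (hcon false)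
  rw [← ENNReal.ofReal_add (by positivity) (by positivity)] at h2
  have h3 := htotal.trans_lt h2
  rw [show η / 16 + η / 16 = η / 8 by ring] at h3
  exact lt_irrefl _ h3

/-! ### The mean-estimation instance -/

section TwoPoint

/-- The unit vector of the real line. -/
def unitVec : E 1 := EuclideanSpace.single 0 1

theorem norm_unitVec : ‖unitVec‖ = 1 := by simp [unitVec]

/-- A quadratic loss on the line: the sample `0` carries no information, the samples `1` and `2`
pull towards `A` and `-A`. -/
def twoPointLoss (H A shift : ℝ) (w : E 1) (z : Fin 3) : ℝ :=
  (![0, H, H] z) / 2 * ‖w - (![0, A, -A] z) • unitVec‖ ^ 2 + shift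

/-- The probabilities of the three samples; the sign `s` decides whether `1` or `2` is favoured. -/
def twoPointWeight (p ε : ℝ) (s : Bool) : Fin 3 → ℝ :=
  ![1 - p, p * (1 + bif s then ε else -ε) / 2, p * (1 - bif s then ε else -ε) / 2]

variable {H A shift p ε : ℝ}

theorem quadBounds_twoPointLoss (hH : 0 ≤ H) (z : Fin 3) :
    ∃ g, QuadBounds (fun w => twoPointLoss H A shift w z) g 0 H := by
  refine ⟨_, ((quadBounds_quadratic (![0, H, H] z) ((![0, A, -A] z) • unitVec)).add_const
    shift).mono ?_ ?_⟩ <;> fin_cases z <;> simp [hH]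

theorem twoPointWeight_nonneg (hp0 : 0 ≤ p) (hp1 : p ≤ 1) (hε0 : 0 ≤ ε) (hε1 : ε ≤ 1) (s : Bool)
    (z : Fin 3) : 0 ≤ twoPointWeight p ε s z := by
  fin_cases z <;> cases s <;> simp [twoPointWeight, hp1] <;> first | positivity | skip
  all_goals exact div_nonneg (mul_nonneg hp0 (by linarith)) (by norm_num)

theorem sum_twoPointWeight (s : Bool) : ∑ z, twoPointWeight p ε s z = 1 := by
  simp only [twoPointWeight, Fin.sum_univ_three]
  simp
  ring

/-- Bias-variance decomposition: the informative samples have mean ±εA and variance A²(1 - ε²). -/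
theorem sum_twoPointWeight_mul (s : Bool) (w : E 1) :
    ∑ z, twoPointWeight p ε s z * twoPointLoss H A shift w z =
      p * H / 2 * ‖w - ((bif s then ε else -ε) * A) • unitVec‖ ^ 2 +
        (p * H / 2 * A ^ 2 * (1 - ε ^ 2) + shift) := by
  have e : ∀ c : ℝ, ‖w - c • unitVec‖ ^ 2 = ‖w‖ ^ 2 - 2 * c * inner ℝ w unitVec + c ^ 2 := by
    intro c
    rw [norm_sub_sq_real, inner_smul_right, norm_smul, norm_unitVec, mul_one, Real.norm_eq_abs,
      sq_abs]
    ring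
  simp only [twoPointWeight, twoPointLoss, Fin.sum_univ_three, e]
  cases s <;> simp <;> ring

/-- The affinity equals 1 - p + p√(1 - ε²), and √(1 - ε²) ≥ 1 - ε². -/
theorem one_sub_le_affinity_twoPointWeight (hp1 : p ≤ 1) (hε0 : 0 ≤ ε)
    (hε1 : ε ≤ 1) :
    1 - p * ε ^ 2 ≤ ∑ z, √(twoPointWeight p ε true z * twoPointWeight p ε false z) := by
  have h0 : √((1 - p) * (1 - p)) = 1 - p := Real.sqrt_mul_self (by linarith)
  have hle : p / 2 * (1 - ε ^ 2) ≤ √(p * (1 + ε) / 2 * (p * (1 - ε) / 2)) := by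
    refine Real.le_sqrt_of_sq_le ?_
    have : 0 ≤ (1 - ε ^ 2) * ε ^ 2 := mul_nonneg (by nlinarith) (by positivity)
    have h2 := mul_nonneg (sq_nonneg (p / 2)) this
    nlinarith
  have hle' : p / 2 * (1 - ε ^ 2) ≤ √(p * (1 - ε) / 2 * (p * (1 + ε) / 2)) := by
    rwa [mul_comm (p * (1 - ε) / 2)]
  simp only [twoPointWeight, Fin.sum_univ_three]
  simp [← sub_eq_add_neg]
  rw [h0]
  linarith

/-- The lower bound for estimating a mean from `b T` samples, as an instance of the problem. -/
theorem hardInstance_twoPoint {T b : ℕ} (hH : 0 < H) (hp0 : 0 < p) (hp1 : p ≤ 1)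
    (hε0 : 0 < ε) (hε1 : ε ≤ 1) (hn : p * ε ^ 2 * (b * T) ≤ 1 / 2) {Lstar : ℝ}
    (hL : p * H / 2 * A ^ 2 * (1 - ε ^ 2) ≤ Lstar) :
    HardInstance H (p * H) Lstar (p * H / 2 * A ^ 2 * ε ^ 2) (ε * |A|)
      (p * H * A ^ 2 * ε ^ 2 / 16) T b := by
  -- Raises the minimum from the variance of the pulls to `Lstar`; `hL` keeps the loss non-negative.
  set shift := Lstar - p * H / 2 * A ^ 2 * (1 - ε ^ 2) with hshift
  have hshift0 : 0 ≤ shift := sub_nonneg.2 hL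
  have hqb := fun z => quadBounds_twoPointLoss (A := A) (shift := shift) hH.le z
  have hmeas : ∀ z, Measurable fun w => twoPointLoss H A shift w z := fun z => by
    unfold twoPointLoss; fun_prop
  refine ⟨1, Fin 3, inferInstance, twoPointLoss H A shift, measurableLoss_of_countable hmeas, ?_⟩
  intro Ω _ P _ Alg
  have h0 := twoPointWeight_nonneg hp0.le hp1 hε0.le hε1
  have h1 := sum_twoPointWeight (p := p) (ε := ε)
  have hsum := fun s w => sum_twoPointWeight_mul (H := H) (A := A) (shift := shift) (p := p)
    (ε := ε) s w
  have hconst : p * H / 2 * A ^ 2 * (1 - ε ^ 2) + shift = Lstar := by rw [hshift]; ring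
  simp only [hconst] at hsum
  obtain ⟨s, hs⟩ := le_expectedError_of_affinity Alg P (b := b) (Lstar := Lstar) hmeas h0 h1
    (η := p * H * A ^ 2 * ε ^ 2) (by
      have hb := one_sub_le_affinity_twoPointWeight hp1 hε0.le hε1
      have hpe : p * ε ^ 2 ≤ 1 := mul_le_one₀ hp1 (by positivity) (pow_le_one₀ hε0.le hε1)
      -- Bernoulli: (1 - pε²)^(bT) ≥ 1 - pε² bT ≥ 1/2.
      have hbern := one_add_mul_le_pow (a := -(p * ε ^ 2)) (by linarith) (b * T)
      have := pow_le_pow_left₀ (by linarith) hb (b * T)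
      rw [← sub_eq_add_neg] at hbern
      push_cast at hbern
      linarith) (by positivity) (by
      intro w
      rw [hsum, hsum]
      -- The two minimizers are ±εA, so the two errors add up to pH(‖w‖² + ε²A²).
      have hpar := parallelogram_law_with_norm ℝ w ((ε * A) • unitVec)
      have e1 : ‖(ε * A) • unitVec‖ ^ 2 = ε ^ 2 * A ^ 2 := by
        rw [norm_smul, norm_unitVec, mul_one, Real.norm_eq_abs, sq_abs]; ring
      rw [e1] at hpar
      simp only [cond_true, cond_false, neg_mul, neg_smul, sub_neg_eq_add]
      have : 0 ≤ p * H * ‖w‖ ^ 2 := by positivity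
      linear_combination (p * H / 2) * hpar.symm.le + this)
  have hL : expLoss (twoPointLoss H A shift) (weightMeasure (twoPointWeight p ε s)) =
      fun w => p * H / 2 * ‖w - ((bif s then ε else -ε) * A) • unitVec‖ ^ 2 + Lstar :=
    funext fun w => by rw [expLoss_weightMeasure (h0 s) (h1 s), hsum]
  have hprob := isProbabilityMeasure_weightMeasure (h0 s) (h1 s)
  refine ⟨_, hprob, fun w => Integrable.of_finite, ?_, ?_, hs⟩
  · refine smoothConvexLoss_of_quadBounds (Filter.Eventually.of_forall fun z => ⟨fun w => ?_, hqb z⟩)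
    unfold twoPointLoss
    refine add_nonneg (mul_nonneg (div_nonneg ?_ (by norm_num)) (by positivity)) hshift0
    fin_cases z <;> simp [hH.le]
  · refine ⟨fun w => (p * H) • (w - ((bif s then ε else -ε) * A) • unitVec),
      ((bif s then ε else -ε) * A) • unitVec, ?_, ?_, ?_, ?_, ?_⟩
    · rw [hL]
      exact ((quadBounds_quadratic _ _).add_const _).mono le_rfl (mul_le_of_le_one_left hH.le hp1)
    · simp
    · rw [hL]; simp
    · rw [norm_smul, norm_unitVec, mul_one, Real.norm_eq_abs, abs_mul]
      cases s <;> simp [abs_of_pos hε0]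
    · rw [hL]
      simp only [zero_sub, norm_neg, norm_smul, norm_unitVec, mul_one, Real.norm_eq_abs, sq_abs]
      cases s <;> simp <;> apply le_of_eq <;> ring

end TwoPoint


/-! ### Proximal points and Moreau envelopes over a ball -/

section Prox

variable {V : Type*} [NormedAddCommGroup V] [InnerProductSpace ℝ V]

/-- The variational inequality that characterizes the minimizer `p` of `F u + K / 2 * ‖w - u‖ ^ 2`
over the ball of radius `R`. -/
def IsProx (K R : ℝ) (F : V → ℝ) (w p : V) : Prop :=
  ‖p‖ ≤ R ∧ ∀ u, ‖u‖ ≤ R → F p + K * inner ℝ (w - p) (u - p) ≤ F u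

/-- The proximal point of `F` over the ball of radius `R`. -/
def prox (K R : ℝ) (F : V → ℝ) (w : V) : V := Classical.epsilon (IsProx K R F w)

/-- The Moreau envelope of the restriction of `F` to the ball of radius `R`. -/
def envelope (K R : ℝ) (F : V → ℝ) (w : V) : ℝ :=
  F (prox K R F w) + K / 2 * ‖w - prox K R F w‖ ^ 2

variable {K R : ℝ} {F : V → ℝ}

/-- A minimizer exists by compactness. Moving it by t towards u changes the objective by a term of
order t, which must not be negative, up to an error of order t². -/
theorem exists_isProx [ProperSpace V] (hK : 0 ≤ K) (hR : 0 ≤ R) (hF : ConvexOn ℝ Set.univ F)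
    (hc : Continuous F) (w : V) : ∃ p, IsProx K R F w p := by
  obtain ⟨p, hpR, hp⟩ := (isCompact_closedBall (0 : V) R).exists_isMinOn
    ⟨0, Metric.mem_closedBall_self hR⟩
    (f := fun u => F u + K / 2 * ‖w - u‖ ^ 2) (by fun_prop)
  have hpR' : ‖p‖ ≤ R := by simpa using hpR
  refine ⟨p, hpR', fun u hu => ?_⟩
  by_contra hcon
  push Not at hcon
  set g := F p + K * inner ℝ (w - p) (u - p) - F u with hg
  have hg0 : 0 < g := by linarith
  have key : ∀ t : ℝ, 0 < t → t ≤ 1 → g ≤ t * (K / 2 * ‖u - p‖ ^ 2) := by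
    intro t ht0 ht1
    have hmem : p + t • (u - p) = (1 - t) • p + t • u := by module
    have hball : p + t • (u - p) ∈ Metric.closedBall (0 : V) R := by
      rw [hmem]
      exact (convex_closedBall (0 : V) R) hpR (by simpa using hu) (by linarith) ht0.le (by ring)
    have h1 : F p + K / 2 * ‖w - p‖ ^ 2 ≤
        F (p + t • (u - p)) + K / 2 * ‖w - (p + t • (u - p))‖ ^ 2 := hp hball
    have h2 : F (p + t • (u - p)) ≤ (1 - t) * F p + t * F u := by
      rw [hmem]
      exact hF.2 (Set.mem_univ _) (Set.mem_univ _) (by linarith) ht0.le (by ring)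
    have h3 : ‖w - (p + t • (u - p))‖ ^ 2 =
        ‖w - p‖ ^ 2 - 2 * t * inner ℝ (w - p) (u - p) + t ^ 2 * ‖u - p‖ ^ 2 := by
      rw [show w - (p + t • (u - p)) = (w - p) - t • (u - p) by abel, norm_sub_sq_real,
        inner_smul_right, norm_smul, mul_pow, Real.norm_eq_abs, sq_abs]
      ring
    rw [h3] at h1
    have h4 : t * g ≤ t * (t * (K / 2 * ‖u - p‖ ^ 2)) := by
      rw [hg]; nlinarith
    exact le_of_mul_le_mul_left h4 ht0
  set c := K / 2 * ‖u - p‖ ^ 2 with hcdef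
  have hc0 : 0 ≤ c := by positivity
  -- This t makes the bound in `key` at most g/2, which contradicts g > 0.
  have h := key (min 1 (g / (2 * (c + 1)))) (by positivity) (min_le_left _ _)
  have h' : min 1 (g / (2 * (c + 1))) * c ≤ g / (2 * (c + 1)) * c :=
    mul_le_mul_of_nonneg_right (min_le_right _ _) hc0
  have h'' : g / (2 * (c + 1)) * c ≤ g / 2 := by
    rw [div_mul_eq_mul_div, div_le_div_iff₀ (by positivity) (by norm_num)]
    nlinarith
  linarith

theorem IsProx.unique (hK : 0 < K) {w p p' : V} (h : IsProx K R F w p) (h' : IsProx K R F w p') :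
    p = p' := by
  have h1 := h.2 p' h'.1
  have h2 := h'.2 p h.1
  have e : inner ℝ (w - p) (p' - p) + inner ℝ (w - p') (p - p') = ‖p' - p‖ ^ 2 := by
    rw [← real_inner_self_eq_norm_sq, ← neg_sub p' p, inner_neg_right, ← sub_eq_add_neg,
      ← inner_sub_left]
    congr 1; abel
  have h3 : ‖p' - p‖ ^ 2 ≤ 0 := by
    by_contra hcon
    push Not at hcon
    nlinarith [mul_pos hK hcon]
  have h4 : ‖p' - p‖ = 0 := by nlinarith [norm_nonneg (p' - p)]
  exact (sub_eq_zero.1 (norm_eq_zero.1 h4)).symm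

/-- Adding a function `g` to `F` moves the proximal point by an amount that `g` controls. -/
theorem IsProx.sq_dist_le {g : V → ℝ} {w p p' : V} (h : IsProx K R F w p)
    (h' : IsProx K R (fun u => F u + g u) w p') : K * ‖p' - p‖ ^ 2 ≤ g p - g p' := by
  have h1 := h.2 p' h'.1
  have h2 := h'.2 p h.1
  have e : inner ℝ (w - p) (p' - p) + inner ℝ (w - p') (p - p') = ‖p' - p‖ ^ 2 := by
    rw [← real_inner_self_eq_norm_sq, ← neg_sub p' p, inner_neg_right, ← sub_eq_add_neg,
      ← inner_sub_left]
    congr 1; abel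
  rw [← e]
  linarith

/-- Raising `F` without changing its value at the proximal point keeps that point. This is how
inactive links go unnoticed. -/
theorem IsProx.of_le {F' : V → ℝ} {w p : V} (h : IsProx K R F w p) (hp : F' p = F p)
    (hle : ∀ u, F u ≤ F' u) : IsProx K R F' w p :=
  ⟨h.1, fun u hu => by rw [hp]; exact (h.2 u hu).trans (hle u)⟩

theorem IsProx.prox_eq (hK : 0 < K) {w p : V} (h : IsProx K R F w p) : prox K R F w = p :=
  IsProx.unique hK (Classical.epsilon_spec ⟨p, h⟩) h

/-- The lower bound inserts the variational inequality at u, and the upper one compares with the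
proximal point of u as a candidate for w; after expanding squares both leave a non-negative square
over. -/
theorem quadBounds_envelope (hK : 0 ≤ K) (h : ∀ w, IsProx K R F w (prox K R F w)) :
    QuadBounds (envelope K R F) (fun w => K • (w - prox K R F w)) 0 K := by
  intro w u
  have hu := (h u).2 _ (h w).1
  have hw := (h w).2 _ (h u).1
  simp only [envelope, inner_smul_left, conj_trivial, zero_div, zero_mul, add_zero]
  set p := prox K R F w
  set p' := prox K R F u
  have key : ∀ x y : V, ‖x‖ ^ 2 = ‖y‖ ^ 2 + 2 * inner ℝ y (x - y) + ‖x - y‖ ^ 2 := by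
    intro x y
    rw [← norm_add_sq_real]; congr 2; abel
  constructor
  · have e := key (w - p) (u - p')
    have e2 : inner ℝ (u - p') (w - p - (u - p')) =
        inner ℝ (u - p') (w - u) - inner ℝ (u - p') (p - p') := by
      rw [← inner_sub_right]; congr 1; abel
    rw [e2] at e
    have : 0 ≤ K / 2 * ‖w - p - (u - p')‖ ^ 2 := by positivity
    rw [e]
    linarith
  · have e := key (w - p') (u - p')
    have e3 := key (w - p') (w - p)
    rw [show w - p' - (u - p') = w - u by abel] at e
    rw [show w - p' - (w - p) = p - p' by abel] at e3
    have e4 : inner ℝ (w - p) (p' - p) = - inner ℝ (w - p) (p - p') := by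
      rw [← inner_neg_right, neg_sub]
    rw [e4] at hw
    have : 0 ≤ K / 2 * ‖p - p'‖ ^ 2 := by positivity
    have e5 : K / 2 * ‖w - p'‖ ^ 2 = K / 2 * ‖u - p'‖ ^ 2 + K * inner ℝ (u - p') (w - u)
      + K / 2 * ‖w - u‖ ^ 2 := by rw [e]; ring
    have e6 : K / 2 * ‖w - p'‖ ^ 2 = K / 2 * ‖w - p‖ ^ 2 + K * inner ℝ (w - p) (p - p')
      + K / 2 * ‖p - p'‖ ^ 2 := by rw [e3]; ring
    linarith

theorem envelope_le (hK : 0 ≤ K) {w u : V} (h : IsProx K R F w (prox K R F w)) (hu : ‖u‖ ≤ R) :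
    envelope K R F w ≤ F u + K / 2 * ‖w - u‖ ^ 2 := by
  have h1 := h.2 u hu
  simp only [envelope]
  set p := prox K R F w
  have e : ‖w - u‖ ^ 2 = ‖w - p‖ ^ 2 - 2 * inner ℝ (w - p) (u - p) + ‖u - p‖ ^ 2 := by
    rw [← norm_sub_sq_real]; congr 2; abel
  have : 0 ≤ K / 2 * ‖u - p‖ ^ 2 := by positivity
  rw [e]
  linarith

end Prox


/-! ### The chain of hinges -/

section Chain

variable {N n : ℕ}

/-- The coordinate number `π j` of the block number `j`. -/
def slot (π : Fin N → Fin n) (j : Fin N) : Fin (N * n) := finProdFinEquiv (j, π j)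

theorem slot_injective (π : Fin N → Fin n) : Function.Injective (slot π) := fun i j h => by
  have := finProdFinEquiv.injective h
  exact (Prod.ext_iff.1 this).1

/-- The coordinates of `u` along the chain of slots, after an initial value `a`. -/
def chainCoord (a : ℝ) (π : Fin N → Fin n) (u : E (N * n)) : ℕ → ℝ
  | 0 => a
  | j + 1 => if h : j < N then u (slot π ⟨j, h⟩) else 0

/-- The link number `j` of the chain: a hinge that is active when the coordinates drop by more
than `c j` from one slot to the next. -/
def chainLink (G c : ℕ → ℝ) (a : ℝ) (π : Fin N → Fin n) (j : ℕ) (u : E (N * n)) : ℝ :=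
  G j * max 0 (chainCoord a π u j - chainCoord a π u (j + 1) - c j)

/-- The sum of the first `k` links. -/
def chain (G c : ℕ → ℝ) (a : ℝ) (π : Fin N → Fin n) (k : ℕ) (u : E (N * n)) : ℝ :=
  ∑ j ∈ Finset.range k, chainLink G c a π j u

variable {G c : ℕ → ℝ} {a : ℝ} {π : Fin N → Fin n}

theorem continuous_chainCoord (j : ℕ) : Continuous fun u => chainCoord a π u j := by
  cases j with
  | zero => exact continuous_const
  | succ j =>
    simp only [chainCoord]
    split_ifs <;> fun_prop

theorem continuous_chain (k : ℕ) : Continuous (chain G c a π k) := by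
  have h := fun j => continuous_chainCoord (a := a) (π := π) j
  unfold chain chainLink
  fun_prop

theorem chainCoord_combo (j : ℕ) (u v : E (N * n)) {r s : ℝ} (hrs : r + s = 1) :
    chainCoord a π (r • u + s • v) j = r * chainCoord a π u j + s * chainCoord a π v j := by
  cases j with
  | zero => simp only [chainCoord]; rw [← add_mul, hrs, one_mul]
  | succ j => simp only [chainCoord]; split_ifs <;> simp

theorem chainLink_nonneg (hG : ∀ j, 0 ≤ G j) (j : ℕ) (u : E (N * n)) :
    0 ≤ chainLink G c a π j u := mul_nonneg (hG j) (le_max_left _ _)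

theorem convexOn_chain (hG : ∀ j, 0 ≤ G j) (k : ℕ) : ConvexOn ℝ Set.univ (chain G c a π k) := by
  refine ⟨convex_univ, fun u _ v _ r s hr hs hrs => ?_⟩
  simp only [chain, smul_eq_mul, Finset.mul_sum, ← Finset.sum_add_distrib]
  refine Finset.sum_le_sum fun j _ => ?_
  simp only [chainLink, chainCoord_combo _ u v hrs]
  set x := chainCoord a π u j - chainCoord a π u (j + 1) - c j with hx
  set y := chainCoord a π v j - chainCoord a π v (j + 1) - c j with hy
  have e : r * chainCoord a π u j + s * chainCoord a π v j -
      (r * chainCoord a π u (j + 1) + s * chainCoord a π v (j + 1)) - c j = r * x + s * y := by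
    rw [hx, hy]
    linear_combination (c j) * hrs
  rw [e]
  have hmax : max 0 (r * x + s * y) ≤ r * max 0 x + s * max 0 y :=
    max_le (by positivity) (by
      have := mul_le_mul_of_nonneg_left (le_max_right 0 x) hr
      have := mul_le_mul_of_nonneg_left (le_max_right 0 y) hs
      linarith)
  calc G j * max 0 (r * x + s * y) ≤ G j * (r * max 0 x + s * max 0 y) :=
        mul_le_mul_of_nonneg_left hmax (hG j)
    _ = _ := by ring

theorem chain_nonneg (hG : ∀ j, 0 ≤ G j) (k : ℕ) (u : E (N * n)) : 0 ≤ chain G c a π k u :=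
  Finset.sum_nonneg fun j _ => chainLink_nonneg hG j u

theorem chain_succ (k : ℕ) :
    chain G c a π (k + 1) = fun u => chain G c a π k u + chainLink G c a π k u :=
  funext fun _ => Finset.sum_range_succ _ _

theorem isProx_chain {K R : ℝ} (hK : 0 ≤ K) (hR : 0 ≤ R) (hG : ∀ j, 0 ≤ G j) (k : ℕ)
    (w : E (N * n)) : IsProx K R (chain G c a π k) w (prox K R (chain G c a π k) w) :=
  Classical.epsilon_spec (exists_isProx hK hR (convexOn_chain hG k) (continuous_chain k) w)

theorem chainCoord_congr {π' : Fin N → Fin n} {k j : ℕ} (h : ∀ i : Fin N, (i : ℕ) < k → π i = π' i)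
    (hj : j ≤ k) (u : E (N * n)) : chainCoord a π u j = chainCoord a π' u j := by
  cases j with
  | zero => rfl
  | succ j =>
    simp only [chainCoord, slot]
    split_ifs with hN
    · rw [h ⟨j, hN⟩ (by simpa using hj)]
    · rfl

/-- The first `k` links only depend on the first `k` slots. -/
theorem chain_congr {π' : Fin N → Fin n} {k : ℕ} (h : ∀ i : Fin N, (i : ℕ) < k → π i = π' i) :
    chain G c a π k = chain G c a π' k := by
  funext u
  refine Finset.sum_congr rfl fun j hj => ?_
  have hj := Finset.mem_range.1 hj
  rw [chainLink, chainLink, chainCoord_congr h hj.le, chainCoord_congr h hj]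

theorem sum_sq_slot_le (π : Fin N → Fin n) (s : Finset (Fin N)) (u : E (N * n)) :
    ∑ j ∈ s, u (slot π j) ^ 2 ≤ ‖u‖ ^ 2 := by
  rw [EuclideanSpace.norm_sq_eq]
  simp only [Real.norm_eq_abs, sq_abs]
  rw [← Finset.sum_image (f := fun i => u i ^ 2) (g := slot π)
    fun i _ j _ h => slot_injective π h]
  exact Finset.sum_le_sum_of_subset_of_nonneg (Finset.subset_univ _) fun i _ _ => sq_nonneg _

/-- A drop is a difference of two distinct coordinates, or of one coordinate and a constant, hence
√2-Lipschitz. -/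
theorem chainCoord_sub_le (j : ℕ) (u v : E (N * n)) :
    (chainCoord a π u j - chainCoord a π u (j + 1)) -
      (chainCoord a π v j - chainCoord a π v (j + 1)) ≤ √2 * ‖u - v‖ := by
  set x : ℕ → ℝ := fun i => chainCoord a π u i - chainCoord a π v i with hx
  have hsq : x j ^ 2 + x (j + 1) ^ 2 ≤ ‖u - v‖ ^ 2 := by
    have hx' : ∀ i, (h : i < N) → x (i + 1) = (u - v) (slot π ⟨i, h⟩) := by
      intro i h; simp [hx, chainCoord, h]
    have hx'' : ∀ i, ¬ i < N → x (i + 1) = 0 := by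
      intro i h; simp [hx, chainCoord, h]
    have h1 : ∀ i, x (i + 1) ^ 2 ≤ ‖u - v‖ ^ 2 := by
      intro i
      by_cases h : i < N
      · simpa [hx' i h] using sum_sq_slot_le π {⟨i, h⟩} (u - v)
      · rw [hx'' i h]; simp
    cases j with
    | zero => simpa [hx, chainCoord] using h1 0
    | succ j =>
      by_cases h : j + 1 < N
      · have hj : j < N := by omega
        have := sum_sq_slot_le π {⟨j, hj⟩, ⟨j + 1, h⟩} (u - v)
        rw [Finset.sum_pair (by simp), ← hx' j hj, ← hx' (j + 1) h] at this
        exact this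
      · rw [hx'' (j + 1) h]
        simpa using h1 j
  have : x j - x (j + 1) ≤ √2 * ‖u - v‖ := by
    rw [← Real.sqrt_sq (norm_nonneg (u - v)), ← Real.sqrt_mul (by norm_num)]
    refine Real.le_sqrt_of_sq_le ?_
    nlinarith [sq_nonneg (x j + x (j + 1))]
  simp only [hx] at this
  linarith

theorem chainLink_sub_le (hG : ∀ j, 0 ≤ G j) (j : ℕ) (u v : E (N * n)) :
    chainLink G c a π j u - chainLink G c a π j v ≤ G j * (√2 * ‖u - v‖) := by
  rw [chainLink, chainLink, ← mul_sub]
  refine mul_le_mul_of_nonneg_left ?_ (hG j)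
  have := chainCoord_sub_le (a := a) (π := π) j u v
  have h0 : 0 ≤ √2 * ‖u - v‖ := by positivity
  have h1 := le_max_right 0 (chainCoord a π v j - chainCoord a π v (j + 1) - c j)
  have h2 := le_max_left 0 (chainCoord a π v j - chainCoord a π v (j + 1) - c j)
  have : max 0 (chainCoord a π u j - chainCoord a π u (j + 1) - c j) ≤
      max 0 (chainCoord a π v j - chainCoord a π v (j + 1) - c j) + √2 * ‖u - v‖ :=
    max_le (by linarith) (by linarith)
  linarith

/-- A query at which the slots after the first `k` have not been found reveals one slot at most. -/
theorem prox_chain_eq {K R δ : ℝ} (hK : 0 < K) (hR : 0 ≤ R) (hG : ∀ j, 0 ≤ G j)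
    (hc : ∀ j, j + 1 < N → 2 * δ + √2 * G j / K ≤ c (j + 1)) {k : ℕ} (hk : k < N) {w : E (N * n)}
    (h0 : ∀ j : Fin N, k ≤ j → |prox K R (chain G c a π k) w (slot π j)| ≤ δ)
    (h1 : ∀ j : Fin N, k + 1 ≤ j → |prox K R (chain G c a π (k + 1)) w (slot π j)| ≤ δ) :
    prox K R (chain G c a π N) w = prox K R (chain G c a π (k + 1)) w := by
  have hp0 := isProx_chain (c := c) (a := a) (π := π) hK.le hR hG k w
  have hp1 := isProx_chain (c := c) (a := a) (π := π) hK.le hR hG (k + 1) w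
  set p0 := prox K R (chain G c a π k) w
  set p1 := prox K R (chain G c a π (k + 1)) w
  have hδ : 0 ≤ δ := (abs_nonneg _).trans (h0 ⟨k, hk⟩ le_rfl)
  -- The new link is √2 G k-Lipschitz, so adding it moves the proximal point by at most √2 G k / K.
  have hdist : ‖p1 - p0‖ ≤ √2 * G k / K := by
    have h2 := hp0.sq_dist_le (g := chainLink G c a π k) (by rw [← chain_succ]; exact hp1)
    have h3 := h2.trans (chainLink_sub_le hG k p0 p1)
    rw [norm_sub_rev p0 p1] at h3
    rw [le_div_iff₀ hK]
    rcases (norm_nonneg (p1 - p0)).eq_or_lt with h | h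
    · rw [← h, zero_mul]; exact mul_nonneg (Real.sqrt_nonneg _) (hG k)
    · refine le_of_mul_le_mul_right ?_ h
      linarith
  have hcoord : ∀ j, k + 1 ≤ j → |chainCoord a π p1 (j + 1)| ≤ δ := by
    intro j hj
    simp only [chainCoord]
    split_ifs with h
    · exact h1 ⟨j, h⟩ hj
    · simpa using hδ
  have hnext : chainCoord a π p1 (k + 1) ≤ δ + √2 * G k / K := by
    simp only [chainCoord, hk, dif_pos]
    have e1 : (p1 - p0) (slot π ⟨k, hk⟩) ≤ ‖p1 - p0‖ :=
      (le_abs_self _).trans (by simpa using PiLp.norm_apply_le (p1 - p0) (slot π ⟨k, hk⟩))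
    have e2 := (le_abs_self _).trans (h0 ⟨k, hk⟩ le_rfl)
    simp only [PiLp.sub_apply] at e1
    linarith
  -- At `p1` the drops in links after number k are at most 2δ + √2 G / K, below their thresholds.
  -- These links vanish there and are non-negative elsewhere, so the proximal point does not move.
  refine IsProx.prox_eq hK (hp1.of_le ?_ ?_)
  · refine (Finset.sum_subset (Finset.range_subset_range.2 hk) fun j hjN hj => ?_).symm
    rw [Finset.mem_range, not_lt] at hj
    have hle : chainCoord a π p1 j - chainCoord a π p1 (j + 1) - c j ≤ 0 := by
      obtain ⟨i, rfl⟩ : ∃ i, j = i + 1 := ⟨j - 1, by omega⟩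
      have e1 := (abs_le.1 (hcoord (i + 1) hj)).1
      have e2 := hc i (Finset.mem_range.1 hjN)
      have e3 : 0 ≤ √2 * G i / K := div_nonneg (mul_nonneg (Real.sqrt_nonneg _) (hG i)) hK.le
      rcases (show k ≤ i by omega).eq_or_lt with rfl | hlt
      · linarith
      · have := (abs_le.1 (hcoord i hlt)).2
        linarith
    rw [chainLink, max_eq_left hle, mul_zero]
  · intro u
    exact Finset.sum_le_sum_of_subset_of_nonneg (Finset.range_subset_range.2 hk)
      fun j _ _ => chainLink_nonneg hG j u

/-- The point with the coordinates `y 1, …, y N` in the slots. -/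
def slotPoint (y : ℕ → ℝ) (π : Fin N → Fin n) : E (N * n) :=
  ∑ j : Fin N, y (j + 1) • EuclideanSpace.single (slot π j) (1 : ℝ)

theorem slotPoint_apply_slot (y : ℕ → ℝ) (j : Fin N) : slotPoint y π (slot π j) = y (j + 1) := by
  simp only [slotPoint, WithLp.ofLp_sum, WithLp.ofLp_smul, Finset.sum_apply, Pi.smul_apply,
    smul_eq_mul]
  rw [Finset.sum_eq_single j]
  · simp
  · intro i _ hij
    simp [(slot_injective π).ne hij.symm]
  · simp

theorem inner_slotPoint (y : ℕ → ℝ) (u : E (N * n)) :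
    inner ℝ (slotPoint y π) u = ∑ j : Fin N, y (j + 1) * u (slot π j) := by
  simp [slotPoint, sum_inner, inner_smul_left, EuclideanSpace.inner_single_left]

theorem norm_slotPoint_le {y : ℕ → ℝ} {a : ℝ} (hy : ∀ j, |y j| ≤ a) :
    ‖slotPoint y π‖ ≤ N * a := by
  refine (norm_sum_le _ _).trans ?_
  simp only [norm_smul, PiLp.norm_single, norm_one, mul_one, Real.norm_eq_abs]
  refine (Finset.sum_le_sum fun j _ => hy _).trans ?_
  simp

theorem sum_mul_sub_succ (τ d : ℕ → ℝ) (M : ℕ) :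
    ∑ j ∈ Finset.range M, τ j * (d j - d (j + 1)) =
      τ 0 * d 0 - τ M * d M - ∑ j ∈ Finset.range M, (τ j - τ (j + 1)) * d (j + 1) := by
  induction M with
  | zero => simp
  | succ M ih => rw [Finset.sum_range_succ, Finset.sum_range_succ, ih]; ring

/-- If the drops of `y` are the thresholds `c`, the point `slotPoint y` minimizes the sum of the
chain and `μ / 2 * ‖u‖ ^ 2`: the negative of `μ • slotPoint y` is a subgradient of the chain. -/
theorem chain_subgradient {y τ : ℕ → ℝ} {μ : ℝ} (hc : ∀ j, c j = y j - y (j + 1))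
    (hτ0 : ∀ j < N, 0 ≤ τ j) (hτG : ∀ j < N, τ j ≤ G j) (hτN : τ N = 0)
    (hτ : ∀ j < N, τ j - τ (j + 1) = μ * y (j + 1)) (u : E (N * n)) :
    -μ * inner ℝ (slotPoint y π) (u - slotPoint y π) ≤ chain G c (y 0) π N u := by
  set d : ℕ → ℝ := fun j => chainCoord (y 0) π u j - y j with hd
  have h1 : ∑ j ∈ Finset.range N, τ j * (d j - d (j + 1)) ≤ chain G c (y 0) π N u := by
    refine Finset.sum_le_sum fun j hj => ?_
    have hj := Finset.mem_range.1 hj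
    have e : d j - d (j + 1) =
        chainCoord (y 0) π u j - chainCoord (y 0) π u (j + 1) - c j := by
      rw [hc, hd]; ring
    rw [e, chainLink]
    exact (mul_le_mul_of_nonneg_left (le_max_right 0 _) (hτ0 j hj)).trans
      (mul_le_mul_of_nonneg_right (hτG j hj) (le_max_left _ _))
  -- Summation by parts; the boundary terms vanish because d 0 = 0 (both sequences start at y 0) and
  -- τ N = 0.
  refine le_trans (le_of_eq ?_) h1
  have hd0 : d 0 = 0 := by simp [hd, chainCoord]
  rw [sum_mul_sub_succ, hd0, hτN, inner_slotPoint, Finset.sum_range, Finset.mul_sum]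
  simp only [mul_zero, zero_mul, zero_sub, sub_zero, ← Finset.sum_neg_distrib]
  refine Finset.sum_congr rfl fun j _ => ?_
  rw [hτ j j.2]
  simp only [PiLp.sub_apply, slotPoint_apply_slot, hd, chainCoord, j.2, dif_pos, Fin.eta]
  ring

theorem chain_slotPoint {y : ℕ → ℝ} (hc : ∀ j, c j = y j - y (j + 1)) :
    chain G c (y 0) π N (slotPoint y π) = 0 := by
  refine Finset.sum_eq_zero fun j hj => ?_
  have hj := Finset.mem_range.1 hj
  have h : ∀ i ≤ N, chainCoord (y 0) π (slotPoint y π) i = y i := by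
    intro i hi
    cases i with
    | zero => rfl
    | succ i =>
      have hi' : i < N := hi
      simp only [chainCoord, hi', dif_pos, slotPoint_apply_slot]
  rw [chainLink, h j hj.le, h (j + 1) hj, hc]
  simp

/-- At the origin only the first link, fed by the constant `a`, can be active. This value bounds the
initial gap. -/
theorem chain_zero (hc : ∀ j, 0 ≤ c j) (hN : 0 < N) (hca : c 0 ≤ a) :
    chain G c a π N 0 = G 0 * (a - c 0) := by
  rw [chain, Finset.sum_eq_single 0]
  · have : chainCoord a π (0 : E (N * n)) 1 = 0 := by simp [chainCoord]
    rw [chainLink, zero_add, this, chainCoord, max_eq_right (by linarith)]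
    ring
  · intro j _ hj
    obtain ⟨i, rfl⟩ := Nat.exists_eq_succ_of_ne_zero hj
    have := hc (i + 1)
    simp [chainLink, chainCoord, this]
  · simp [hN]

end Chain


/-! ### Hidden slots are rarely hit -/

section Counting

variable {N n : ℕ}

/-- If φ π ignores π j, then π j is uniform and independent of φ π, so sampling at π j averages over
the block. -/
theorem mul_sum_apply_self {φ : (Fin N → Fin n) → Fin n → ℝ} (j : Fin N)
    (h : ∀ π π', (∀ i, i ≠ j → π i = π' i) → φ π = φ π') :
    n * ∑ π, φ π (π j) = ∑ π, ∑ x, φ π x := by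
  rw [← (Equiv.funSplitAt j (Fin n)).symm.sum_comp,
    ← (Equiv.funSplitAt j (Fin n)).symm.sum_comp (fun π => ∑ x, φ π x)]
  simp only [Fintype.sum_prod_type]
  have e1 : ∀ (x : Fin n) (ρ : {i // i ≠ j} → Fin n),
      (Equiv.funSplitAt j (Fin n)).symm (x, ρ) j = x := by
    intro x ρ; simp [Equiv.funSplitAt, Equiv.piSplitAt]
  have e2 : ∀ (x x' : Fin n) (ρ : {i // i ≠ j} → Fin n),
      φ ((Equiv.funSplitAt j (Fin n)).symm (x, ρ)) =
        φ ((Equiv.funSplitAt j (Fin n)).symm (x', ρ)) := by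
    intro x x' ρ
    refine h _ _ fun i hi => ?_
    simp [Equiv.funSplitAt, Equiv.piSplitAt, hi]
  simp only [e1]
  have : ∀ x : Fin n, ∑ ρ, ∑ x', φ ((Equiv.funSplitAt j (Fin n)).symm (x, ρ)) x' =
      ∑ x', ∑ ρ, φ ((Equiv.funSplitAt j (Fin n)).symm (x', ρ)) x' := by
    intro x
    rw [Finset.sum_comm]
    exact Finset.sum_congr rfl fun x' _ => Finset.sum_congr rfl fun ρ _ => by rw [e2 x x' ρ]
  simp [this]

/-- If `g i` is a bounded function of the first `κ i` slots, then at most half of all choices of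
slots give some `g i` a large coordinate in a later slot. -/
theorem two_mul_card_large_slot_le {I : Type} [Fintype I]
    {g : I → (Fin N → Fin n) → E (N * n)} {κ : I → ℕ} {R δ : ℝ} (hδ : 0 < δ)
    (hg : ∀ i π, ‖g i π‖ ≤ R)
    (hκ : ∀ i π π', (∀ j : Fin N, (j : ℕ) < κ i → π j = π' j) → g i π = g i π')
    (hn0 : 0 < n) (hn : 2 * (Fintype.card I * N * R ^ 2) ≤ δ ^ 2 * n) :
    2 * (Finset.univ.filter fun π : Fin N → Fin n =>
      ∃ i, ∃ j : Fin N, κ i ≤ j ∧ δ < |g i π (slot π j)|).card ≤ Fintype.card (Fin N → Fin n) := by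
  classical
  set C : ℝ := (Fintype.card (Fin N → Fin n) : ℝ)
  have hn0' : (0 : ℝ) < n := by exact_mod_cast hn0
  -- Since g i does not know slot j, its mean square there is at most R²/n.
  have hsum : ∀ i, ∀ j : Fin N, κ i ≤ j → n * ∑ π, g i π (slot π j) ^ 2 ≤ C * R ^ 2 := by
    intro i j hij
    have h := mul_sum_apply_self (φ := fun π x => g i π (finProdFinEquiv (j, x)) ^ 2) j (by
      intro π π' h
      funext x
      simp only
      rw [hκ i π π' fun j' hj' => h j' (by rintro rfl; omega)])
    refine (le_of_eq h).trans ?_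
    calc ∑ π, ∑ x, g i π (finProdFinEquiv (j, x)) ^ 2 ≤ ∑ _π : Fin N → Fin n, R ^ 2 := by
          refine Finset.sum_le_sum fun π _ => ?_
          refine le_trans ?_ (pow_le_pow_left₀ (norm_nonneg _) (hg i π) 2)
          rw [EuclideanSpace.norm_sq_eq, ← finProdFinEquiv.sum_comp, Fintype.sum_prod_type]
          simp only [Real.norm_eq_abs, sq_abs]
          exact Finset.single_le_sum
            (f := fun j => ∑ x, g i π (finProdFinEquiv (j, x)) ^ 2)
            (fun j _ => Finset.sum_nonneg fun x _ => sq_nonneg _) (Finset.mem_univ j)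
      _ = C * R ^ 2 := by simp [C]
  set S := Finset.univ.filter fun π : Fin N → Fin n =>
      ∃ i, ∃ j : Fin N, κ i ≤ j ∧ δ < |g i π (slot π j)|
  -- Markov's inequality combined with a union bound over all i and all hidden j.
  have hS : δ ^ 2 * S.card ≤ ∑ π, ∑ i, ∑ j : Fin N,
      if κ i ≤ (j : ℕ) then g i π (slot π j) ^ 2 else 0 := by
    have hnn : ∀ (π : Fin N → Fin n) i (j : Fin N),
        0 ≤ if κ i ≤ (j : ℕ) then g i π (slot π j) ^ 2 else 0 := by
      intro π i j; split_ifs <;> positivity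
    calc δ ^ 2 * S.card = ∑ _π ∈ S, δ ^ 2 := by simp [mul_comm]
      _ ≤ ∑ π ∈ S, ∑ i, ∑ j : Fin N, if κ i ≤ (j : ℕ) then g i π (slot π j) ^ 2 else 0 := by
        refine Finset.sum_le_sum fun π hπ => ?_
        obtain ⟨i, j, hij, hlt⟩ := (Finset.mem_filter.1 hπ).2
        calc δ ^ 2 ≤ if κ i ≤ (j : ℕ) then g i π (slot π j) ^ 2 else 0 := by
              rw [if_pos hij, ← sq_abs (g i π (slot π j))]
              exact pow_le_pow_left₀ hδ.le hlt.le 2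
          _ ≤ ∑ j : Fin N, if κ i ≤ (j : ℕ) then g i π (slot π j) ^ 2 else 0 :=
              Finset.single_le_sum (f := fun j : Fin N =>
                if κ i ≤ (j : ℕ) then g i π (slot π j) ^ 2 else 0) (fun j _ => hnn π i j)
                (Finset.mem_univ j)
          _ ≤ _ := Finset.single_le_sum (f := fun i => ∑ j : Fin N,
                if κ i ≤ (j : ℕ) then g i π (slot π j) ^ 2 else 0)
                (fun i _ => Finset.sum_nonneg fun j _ => hnn π i j) (Finset.mem_univ i)
      _ ≤ _ := Finset.sum_le_sum_of_subset_of_nonneg (Finset.subset_univ _) fun π _ _ =>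
          Finset.sum_nonneg fun i _ => Finset.sum_nonneg fun j _ => hnn π i j
  have hT : n * ∑ π, ∑ i, ∑ j : Fin N, (if κ i ≤ (j : ℕ) then g i π (slot π j) ^ 2 else 0) ≤
      Fintype.card I * N * (C * R ^ 2) := by
    rw [Finset.sum_comm, Finset.mul_sum]
    calc ∑ i, n * ∑ π, ∑ j : Fin N, (if κ i ≤ (j : ℕ) then g i π (slot π j) ^ 2 else 0)
        ≤ ∑ _i : I, N * (C * R ^ 2) := by
          refine Finset.sum_le_sum fun i _ => ?_
          rw [Finset.sum_comm, Finset.mul_sum]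
          calc ∑ j : Fin N, n * ∑ π, (if κ i ≤ (j : ℕ) then g i π (slot π j) ^ 2 else 0)
              ≤ ∑ _j : Fin N, C * R ^ 2 := by
                refine Finset.sum_le_sum fun j _ => ?_
                split_ifs with hij
                · exact hsum i j hij
                · simp only [Finset.sum_const_zero, mul_zero]; positivity
            _ = N * (C * R ^ 2) := by simp
      _ = _ := by simp [mul_assoc]
  have h1 : n * (δ ^ 2 * S.card) ≤ Fintype.card I * N * (C * R ^ 2) :=
    (mul_le_mul_of_nonneg_left hS hn0'.le).trans hT
  have h2 : (2 * S.card : ℝ) ≤ (Fintype.card (Fin N → Fin n) : ℝ) := by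
    change (2 * S.card : ℝ) ≤ C
    have hC : 0 ≤ C := Nat.cast_nonneg _
    have h3 := mul_le_mul_of_nonneg_left hn hC
    have h4 : (n * δ ^ 2) * (2 * S.card) ≤ (n * δ ^ 2) * C := by linarith
    exact le_of_mul_le_mul_left h4 (by positivity)
  exact_mod_cast h2

end Counting

/-- If, for every seed, half of all instances have error at least `e`, then on some instance the
mean error is at least `e / 2`. -/
theorem exists_half_le_lintegral {Ω X : Type} [MeasurableSpace Ω] [Fintype X] [Nonempty X]
    (P : Measure Ω) [IsProbabilityMeasure P] {err : X → Ω → ℝ≥0∞} (hm : ∀ x, Measurable (err x))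
    {e : ℝ≥0∞}
    (h : ∀ ω, ∃ S : Finset X, Fintype.card X ≤ 2 * S.card ∧ ∀ x ∈ S, e ≤ err x ω) :
    ∃ x, e / 2 ≤ ∫⁻ ω, err x ω ∂P := by
  by_contra hcon
  push Not at hcon
  have h1 : ∑ x, ∫⁻ ω, err x ω ∂P < ∑ _x : X, e / 2 := by
    refine ENNReal.sum_lt_sum_of_nonempty Finset.univ_nonempty fun x _ => hcon x
  have h2 : ∑ _x : X, e / 2 ≤ ∑ x, ∫⁻ ω, err x ω ∂P := by
    rw [← lintegral_finsetSum _ fun x _ => hm x]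
    calc ∑ _x : X, e / 2 = ∫⁻ _, ∑ _x : X, e / 2 ∂P := by simp
      _ ≤ _ := lintegral_mono fun ω => by
        obtain ⟨S, hS, hSe⟩ := h ω
        have hS' : (Fintype.card X : ℝ≥0∞) ≤ S.card * 2 := by
          rw [mul_comm]; exact_mod_cast hS
        calc ∑ _x : X, e / 2 = Fintype.card X * (e / 2) := by simp
          _ ≤ S.card * 2 * (e / 2) := by gcongr
          _ = ∑ _x ∈ S, e := by
            rw [mul_assoc, ENNReal.mul_div_cancel (by norm_num) (by norm_num)]; simp
          _ ≤ ∑ x ∈ S, err x ω := Finset.sum_le_sum hSe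
          _ ≤ _ := Finset.sum_le_sum_of_subset (Finset.subset_univ _)
  exact lt_irrefl _ (h1.trans_le h2)

/-! ### Comparing runs, and point-mass distributions -/

section Transcript

variable {d T b : ℕ} {Ω : Type} [MeasurableSpace Ω]

/-- Two runs agree as long as the second one receives the same gradients as the first one. -/
theorem Algorithm.transcript_congr (A : Algorithm d T Ω) {Z Z' : Type} {l : E d → Z → ℝ}
    {l' : E d → Z' → ℝ} {ω : Ω} {ζ : ℕ → Fin b → Z} {ζ' : ℕ → Fin b → Z'} {t : ℕ}
    (h : ∀ i < t, minibatchGrad l (A.query i ω (A.transcript l' ω i fun j => ζ' j)) (ζ i) =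
      minibatchGrad l' (A.query i ω (A.transcript l' ω i fun j => ζ' j)) (ζ' i)) :
    A.transcript l ω t (fun j => ζ j) = A.transcript l' ω t (fun j => ζ' j) := by
  induction t with
  | zero => rfl
  | succ t ih =>
    have ih := ih fun i hi => h i (by omega)
    simp only [Algorithm.transcript, Fin.val_castSucc, Fin.val_last]
    rw [ih, h t (by omega)]

theorem minibatchGrad_const {Z : Type} (hb : 1 ≤ b) (l : E d → Z → ℝ) (w : E d) (z : Z) :
    minibatchGrad l w (fun _ : Fin b => z) = lossGrad l w z := by
  have : (b : ℝ) ≠ 0 := by positivity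
  simp only [minibatchGrad, Finset.sum_const, Finset.card_univ, Fintype.card_fin]
  rw [← Nat.cast_smul_eq_nsmul ℝ, smul_smul, one_div, inv_mul_cancel₀ this, one_smul]

/-- Under a point mass the constant sample array has weight 1; its term alone gives the bound. -/
theorem Algorithm.le_expectedError_dirac {Z : Type} [Fintype Z] [MeasurableSpace Z]
    [MeasurableSingletonClass Z] (A : Algorithm d T Ω) (P : Measure Ω) [IsProbabilityMeasure P]
    {l : E d → Z → ℝ} (x : Z) (hl : Measurable fun w => l w x) (Lstar : ℝ) :
    ∫⁻ ω, ENNReal.ofReal (l (A.run l ω fun _ (_ : Fin b) => x) x - Lstar) ∂P ≤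
      A.expectedError P b l (Measure.dirac x) Lstar := by
  have hL : expLoss l (Measure.dirac x) = fun w => l w x := funext fun w => integral_dirac _ _
  rw [A.expectedError_eq_sum P l _ Lstar (by rw [hL]; exact hl), hL]
  refine le_trans (le_of_eq ?_) (Finset.single_le_sum (fun _ _ => zero_le)
    (Finset.mem_univ fun _ _ => x))
  simp

end Transcript


/-! ### The resisting oracle -/

section ChainLoss

variable {N n : ℕ}

/-- The smooth and strongly convex loss of the first `k` links along the slots `π`. -/
def chainLoss (K lam R : ℝ) (G c : ℕ → ℝ) (a : ℝ) (w : E (N * n)) (x : ℕ × (Fin N → Fin n)) : ℝ :=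
  envelope K R (chain G c a x.2 x.1) w + lam / 2 * ‖w - 0‖ ^ 2

variable {K lam R a : ℝ} {G c : ℕ → ℝ}

theorem quadBounds_chainLoss (hK : 0 ≤ K) (hR : 0 ≤ R) (hG : ∀ j, 0 ≤ G j)
    (x : ℕ × (Fin N → Fin n)) :
    QuadBounds (fun w => chainLoss K lam R G c a w x)
      (fun w => K • (w - prox K R (chain G c a x.2 x.1) w) + lam • (w - 0)) lam (K + lam) := by
  have := (quadBounds_envelope hK fun w => isProx_chain (c := c) (a := a) (π := x.2) hK hR hG
    x.1 w).add (quadBounds_quadratic lam 0)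
  rwa [zero_add] at this

theorem lossGrad_chainLoss (hK : 0 ≤ K) (hR : 0 ≤ R) (hG : ∀ j, 0 ≤ G j) (w : E (N * n))
    (x : ℕ × (Fin N → Fin n)) :
    lossGrad (chainLoss K lam R G c a) w x =
      K • (w - prox K R (chain G c a x.2 x.1) w) + lam • (w - 0) :=
  ((quadBounds_chainLoss hK hR hG x).hasGradientAt w).gradient

variable {T b : ℕ} {Ω : Type} [MeasurableSpace Ω]

/-- The gradients that the algorithm receives when the query number `t` is answered with the
first `t + 1` links only. -/
def revealTranscript (A : Algorithm (N * n) T Ω) (K lam R : ℝ) (G c : ℕ → ℝ) (a : ℝ) (ω : Ω)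
    (b : ℕ) (π : Fin N → Fin n) (t : ℕ) : Fin t → E (N * n) :=
  A.transcript (chainLoss K lam R G c a) ω t (fun j (_ : Fin b) => ((j : ℕ) + 1, π))

/-- Answer number i uses the links up to i only, hence the slots up to i. This supplies the
ignorance of later slots required by the counting bound. -/
theorem revealTranscript_congr (A : Algorithm (N * n) T Ω) (hK : 0 ≤ K) (hR : 0 ≤ R)
    (hG : ∀ j, 0 ≤ G j) (hb : 1 ≤ b) (ω : Ω) {π π' : Fin N → Fin n} {t : ℕ}
    (h : ∀ j : Fin N, (j : ℕ) < t → π j = π' j) :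
    revealTranscript A K lam R G c a ω b π t = revealTranscript A K lam R G c a ω b π' t := by
  refine A.transcript_congr (ζ := fun i _ => (i + 1, π)) (ζ' := fun i _ => (i + 1, π')) ?_
  intro i hi
  simp only [minibatchGrad_const hb, lossGrad_chainLoss hK hR hG]
  rw [chain_congr fun j hj => h j (by omega)]

/-- As long as the later slots stay hidden, the algorithm only sees the links revealed so far. -/
theorem transcript_eq_revealTranscript (A : Algorithm (N * n) T Ω) (hK : 0 < K) (hR : 0 ≤ R)
    (hG : ∀ j, 0 ≤ G j) (hb : 1 ≤ b) {δ : ℝ}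
    (hc : ∀ j, j + 1 < N → 2 * δ + √2 * G j / K ≤ c (j + 1))
    (ω : Ω) {π : Fin N → Fin n} {t : ℕ} (ht : t ≤ N) {l : E (N * n) → (Fin N → Fin n) → ℝ}
    (hl : ∀ w, lossGrad l w π = lossGrad (chainLoss K lam R G c a) w (N, π))
    (h : ∀ i < t, ∀ e : ℕ, e ≤ 1 → ∀ j : Fin N, i + e ≤ j →
      |prox K R (chain G c a π (i + e))
        (A.query i ω (revealTranscript A K lam R G c a ω b π i)) (slot π j)| ≤ δ) :
    A.transcript l ω t (fun _ (_ : Fin b) => π) = revealTranscript A K lam R G c a ω b π t := by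
  refine A.transcript_congr (ζ := fun _ _ => π) (ζ' := fun i _ => (i + 1, π)) ?_
  intro i hi
  simp only [minibatchGrad_const hb, hl, lossGrad_chainLoss hK.le hR hG]
  rw [prox_chain_eq hK hR hG hc (show i < N by omega)]
  · exact h i hi 0 (by omega)
  · exact h i hi 1 le_rfl

/-- The resisting oracle for `T` gradients: a chain of `N > T` links along random slots. -/
theorem hardInstance_chain {N : ℕ} {H K lam : ℝ} {G c y τ : ℕ → ℝ} {Lstar Δ r δ : ℝ}
    (hb : 1 ≤ b) (hTN : T < N) (hlam : 0 < lam) (hlK : lam ≤ K) (hH : K + lam = H)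
    (hL : 0 ≤ Lstar) (hG : ∀ j, 0 ≤ G j) (hy0 : ∀ j, 0 < y j) (hy : Antitone y)
    (hc : ∀ j, c j = y j - y (j + 1)) (hδ : 0 < δ) (hδy : 4 * δ ≤ y N)
    (hcG : ∀ j, j + 1 < N → 2 * δ + √2 * G j / K ≤ c (j + 1))
    (hτ0 : ∀ j < N, 0 ≤ τ j) (hτG : ∀ j < N, τ j ≤ G j) (hτN : τ N = 0)
    (hτ : ∀ j < N, τ j - τ (j + 1) = K * lam / H * y (j + 1))
    (hΔ : G 0 * y 1 ≤ Δ) (hr : 0 ≤ r) (hr2 : 2 * Δ ≤ lam * r ^ 2) :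
    HardInstance H lam Lstar Δ r (lam / 2 * ((N - T) * (y N / 4) ^ 2) / 2) T b := by
  have hK : 0 < K := hlam.trans_le hlK
  have hH0 : 0 < H := by linarith
  have hN0 : 0 < N := by omega
  have hN1 : (1 : ℝ) ≤ N := by exact_mod_cast hN0
  -- Twice the norm bound for `slotPoint`: the ball contains it, and an output outside the ball is
  -- at distance at least N y 0 from the minimizer.
  set R : ℝ := 2 * (N * y 0) with hRdef
  have hR : 0 < R := by have := hy0 0; positivity
  -- Blocks are large enough for the counting bound on 2T + 1 vectors: two proximal points per query
  -- and the output.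
  obtain ⟨n, hn⟩ := exists_nat_gt
    (2 * (Fintype.card (Option (Fin T × Bool)) * N * R ^ 2) / δ ^ 2)
  have hn0' : (0 : ℝ) < n := lt_of_le_of_lt (by positivity) hn
  have hn0 : 0 < n := by exact_mod_cast hn0'
  have hn' : 2 * (Fintype.card (Option (Fin T × Bool)) * N * R ^ 2) ≤ δ ^ 2 * n := by
    rw [div_lt_iff₀ (by positivity)] at hn
    linarith
  have : NeZero n := ⟨hn0.ne'⟩
  have hya : ∀ j, |y j| ≤ y 0 := fun j => by
    rw [abs_of_pos (hy0 j)]; exact hy (Nat.zero_le j)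
  have hu := fun π : Fin N → Fin n => norm_slotPoint_le (π := π) hya
  -- For fixed u, K/2 ‖w - u‖² + λ/2 ‖w‖² is minimal at w = (K/H)u, with value (Kλ/H)/2 ‖u‖². Hence
  -- the factor Kλ/H in `hτ`, and this minimizer.
  set wst : (Fin N → Fin n) → E (N * n) := fun π => (K / H) • slotPoint y π with hwst
  have hKH1 : K / H ≤ 1 := (div_le_one hH0).2 (by linarith)
  have hKH2 : 1 / 2 ≤ K / H := by rw [div_le_div_iff₀ (by norm_num) hH0]; linarith
  set l0 := chainLoss (N := N) (n := n) K lam R G c (y 0) with hl0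
  set l : E (N * n) → (Fin N → Fin n) → ℝ := fun w π =>
    l0 w (N, π) + (Lstar - l0 (wst π) (N, π)) with hl
  have hq0 := fun x => quadBounds_chainLoss (N := N) (n := n) (K := K) (lam := lam) (c := c)
    (a := y 0) hK.le hR.le hG x
  have hq : ∀ π, QuadBounds (fun w => l w π) (fun w => K • (w - prox K R (chain G c (y 0) π N) w)
      + lam • (w - 0)) lam H := fun π => by
    have := (hq0 (N, π)).add_const (Lstar - l0 (wst π) (N, π))
    rwa [hH] at this
  have hprox : ∀ π, prox K R (chain G c (y 0) π N) (wst π) = slotPoint y π := by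
    intro π
    refine IsProx.prox_eq hK ⟨?_, fun u _ => ?_⟩
    · have := hu π
      have : 0 ≤ N * y 0 := mul_nonneg (by linarith) (hy0 0).le
      linarith [hu π]
    · rw [chain_slotPoint hc, zero_add]
      refine le_trans (le_of_eq ?_) (chain_subgradient hc hτ0 hτG hτN hτ u)
      have : wst π - slotPoint y π = (K / H - 1) • slotPoint y π := by
        simp only [hwst]; module
      rw [this, inner_smul_left, conj_trivial, ← mul_assoc]
      congr 1
      rw [← hH]; field_simp; ring
  have hgrad : ∀ π, K • (wst π - prox K R (chain G c (y 0) π N) (wst π)) +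
      lam • (wst π - 0) = 0 := by
    intro π
    rw [hprox]
    simp only [hwst]
    have : K • ((K / H) • slotPoint y π - slotPoint y π) + lam • ((K / H) • slotPoint y π - 0) =
        (K * (K / H) - K + lam * (K / H)) • slotPoint y π := by module
    rw [this, ← hH]
    have : K * (K / (K + lam)) - K + lam * (K / (K + lam)) = 0 := by field_simp; ring
    rw [this, zero_smul]
  have hlwst : ∀ π, l (wst π) π = Lstar := fun π => by simp only [hl]; ring
  have hgrowth : ∀ π w, lam / 2 * ‖w - wst π‖ ^ 2 ≤ l w π - Lstar := by
    intro π w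
    have := (hq π w (wst π)).1
    simp only [hgrad π, inner_zero_left] at this
    have h2 := hlwst π
    linarith
  have hzero : ∀ π, l 0 π - Lstar ≤ Δ := by
    intro π
    have h1 : envelope K R (chain G c (y 0) π N) 0 ≤ G 0 * y 1 := by
      have h := envelope_le hK.le (isProx_chain (c := c) (a := y 0) (π := π) hK.le hR.le hG N 0)
        (u := 0) (by simpa using hR.le)
      have hc0 : ∀ j, 0 ≤ c j := fun j => by rw [hc]; linarith [hy (Nat.le_succ j)]
      rw [chain_zero hc0 hN0 (by rw [hc]; linarith [hy0 (0 + 1)])] at h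
      rw [hc 0] at h
      simpa using h
    have h2 : 0 ≤ l0 (wst π) (N, π) := by
      simp only [hl0, chainLoss, envelope]
      have := chain_nonneg (c := c) (a := y 0) (π := π) hG N
        (prox K R (chain G c (y 0) π N) (wst π))
      positivity
    have h3 : l0 0 (N, π) = envelope K R (chain G c (y 0) π N) 0 := by
      simp [hl0, chainLoss]
    simp only [hl]
    linarith
  have hmeas : ∀ π, Measurable fun w => l w π := fun π =>
    (continuous_iff_continuousAt.2 fun w =>
      ((hq π).hasGradientAt w).continuousAt).measurable
  refine ⟨N * n, Fin N → Fin n, inferInstance, l, measurableLoss_of_countable hmeas, ?_⟩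
  intro Ω _ P _ A
  set e : ℝ := lam / 2 * ((N - T) * (y N / 4) ^ 2) with he
  have hhalf := exists_half_le_lintegral P (X := Fin N → Fin n)
    (err := fun π ω => ENNReal.ofReal (l (A.run l ω fun _ (_ : Fin b) => π) π - Lstar))
    (fun π => (((hmeas π).comp (A.measurable_run _)).sub_const _).ennreal_ofReal)
    (e := ENNReal.ofReal e) ?_
  · obtain ⟨π, hπ⟩ := hhalf
    have hexp : expLoss l (Measure.dirac π) = fun w => l w π := funext fun w => integral_dirac _ _
    refine ⟨Measure.dirac π, inferInstance, fun w => Integrable.of_finite, ?_, ?_, ?_⟩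
    · refine smoothConvexLoss_of_quadBounds ?_
      rw [ae_dirac_eq]
      refine ⟨fun w => ?_, _, (hq π).mono hlam.le le_rfl⟩
      have := hgrowth π w
      have : 0 ≤ lam / 2 * ‖w - wst π‖ ^ 2 := by positivity
      linarith
    · refine ⟨_, wst π, by rw [hexp]; exact hq π, hgrad π, by rw [hexp]; exact hlwst π, ?_,
        by rw [hexp]; exact hzero π⟩
      -- Strong convexity turns the initial gap into the radius: λ/2 ‖wst‖² ≤ Δ ≤ λ/2 r².
      have h1 := hgrowth π 0
      rw [zero_sub, norm_neg] at h1
      have h2 : ‖wst π‖ ^ 2 ≤ r ^ 2 := by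
        have := hzero π
        refine le_of_mul_le_mul_left ?_ hlam
        linarith
      exact (pow_le_pow_iff_left₀ (norm_nonneg _) hr two_ne_zero).1 h2
    · refine le_trans ?_ (A.le_expectedError_dirac P π (hmeas π) Lstar)
      refine le_trans (le_of_eq ?_) hπ
      rw [ENNReal.ofReal_div_of_pos (by norm_num)]
      simp
  · intro ω
    set O : (Fin N → Fin n) → E (N * n) := fun π =>
      A.output ω (revealTranscript A K lam R G c (y 0) ω b π T) with hO
    -- The output is cut off to 0 outside the ball because the counting bound needs bounded vectors;
    -- a large output is treated separately below.
    let g : Option (Fin T × Bool) → (Fin N → Fin n) → E (N * n) := fun i π =>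
      match i with
      | none => if ‖O π‖ ≤ R then O π else 0
      | some (t, s) => prox K R (chain G c (y 0) π (t + s.toNat))
          (A.query t ω (revealTranscript A K lam R G c (y 0) ω b π t))
    let κ : Option (Fin T × Bool) → ℕ := fun i =>
      match i with
      | none => T
      | some (t, s) => t + s.toNat
    have hcount := two_mul_card_large_slot_le (g := g) (κ := κ) (R := R) (δ := δ) hδ ?_ ?_ hn0 hn'
    · refine ⟨Finset.univ.filter fun π : Fin N → Fin n =>
        ¬ ∃ i, ∃ j : Fin N, κ i ≤ j ∧ δ < |g i π (slot π j)|, ?_, ?_⟩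
      · have := Finset.card_filter_add_card_filter_not (s := Finset.univ)
          (fun π : Fin N → Fin n => ∃ i, ∃ j : Fin N, κ i ≤ j ∧ δ < |g i π (slot π j)|)
        rw [Finset.card_univ] at this
        omega
      · intro π hπ
        have hπ := (Finset.mem_filter.1 hπ).2
        push Not at hπ
        refine ENNReal.ofReal_le_ofReal ?_
        have hrun : A.run l ω (fun _ (_ : Fin b) => π) = O π := by
          rw [Algorithm.run, hO, transcript_eq_revealTranscript A (lam := lam) (a := y 0) hK hR.le
            hG hb hcG ω hTN.le]
          · intro w
            rw [lossGrad_chainLoss hK.le hR.le hG, lossGrad,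
              ((hq π).hasGradientAt w).gradient]
          · intro i hi s hs j hj
            have h := hπ (some (⟨i, hi⟩, decide (s = 1))) j
            have hs' : (decide (s = 1)).toNat = s := by interval_cases s <;> rfl
            simp only [κ, g, hs'] at h
            exact h hj
        rw [hrun]
        refine le_trans ?_ (hgrowth π (O π))
        refine mul_le_mul_of_nonneg_left ?_ (by positivity)
        have hyN := hy0 N
        have hyN0 : y N ≤ y 0 := hy (Nat.zero_le N)
        have hTN' : (T : ℝ) ≤ N := by exact_mod_cast hTN.le
        by_cases hOR : ‖O π‖ ≤ R
        -- In each of the last N - T slots the output is at most δ ≤ y N / 4 and the minimizer at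
        -- least y N / 2.
        · have hsmall : ∀ j : Fin N, T ≤ j → |O π (slot π j)| ≤ δ := by
            intro j hj
            have h := hπ none j hj
            simpa only [g, if_pos hOR] using h
          refine le_trans ?_ (sum_sq_slot_le π
            (Finset.univ.filter fun j : Fin N => T ≤ (j : ℕ)) (O π - wst π))
          have hcard : (Finset.univ.filter fun j : Fin N => T ≤ (j : ℕ)).card = N - T := by
            have h1 : (Finset.univ.filter fun j : Fin N => (j : ℕ) < T).card = min N T :=
              Fin.card_filter_val_lt
            have h2 := Finset.card_filter_add_card_filter_not (s := (Finset.univ : Finset (Fin N)))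
              (fun j : Fin N => (j : ℕ) < T)
            simp only [not_lt, Finset.card_univ, Fintype.card_fin] at h2
            omega
          have hcard' : ((Finset.univ.filter fun j : Fin N => T ≤ (j : ℕ)).card : ℝ) = N - T := by
            rw [hcard, Nat.cast_sub hTN.le]
          rw [← hcard', ← nsmul_eq_mul]
          refine Finset.card_nsmul_le_sum _ _ _ fun j hj => ?_
          have h1 := (abs_le.1 (hsmall j (Finset.mem_filter.1 hj).2)).2
          have h2 : y N ≤ y (j + 1) := hy j.2
          have h3 : (O π - wst π) (slot π j) = O π (slot π j) - K / H * y (j + 1) := by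
            simp [hwst, slotPoint_apply_slot]
          rw [h3, ← neg_sq (O π (slot π j) - K / H * y (j + 1))]
          refine pow_le_pow_left₀ (by positivity) ?_ 2
          have h4 : 1 / 2 * y N ≤ K / H * y (j + 1) :=
            mul_le_mul hKH2 h2 hyN.le (by positivity)
          linarith
        · push Not at hOR
          have hw : ‖wst π‖ ≤ N * y 0 := by
            simp only [hwst, norm_smul, Real.norm_eq_abs]
            rw [abs_of_nonneg (by positivity)]
            exact (mul_le_of_le_one_left (norm_nonneg _) hKH1).trans (hu π)
          have h1 : N * y 0 ≤ ‖O π - wst π‖ := by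
            have := norm_sub_norm_le (O π) (wst π)
            linarith
          have h2 : (N * y 0) ^ 2 ≤ ‖O π - wst π‖ ^ 2 := by
            have := hy0 0
            exact pow_le_pow_left₀ (by positivity) h1 2
          refine le_trans ?_ h2
          rw [mul_pow]
          have hT0 : (0 : ℝ) ≤ T := Nat.cast_nonneg T
          refine mul_le_mul (by nlinarith) ?_ (by positivity) (by positivity)
          exact pow_le_pow_left₀ (by positivity) (by linarith) 2
    · rintro (_ | ⟨t, s⟩) π
      · simp only [g]
        split_ifs with h
        · exact h
        · simpa using hR.le
      · exact (isProx_chain hK.le hR.le hG _ _).1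
    · rintro (_ | ⟨t, s⟩) π π' h
      · have h' : O π = O π' := by
          simp only [hO]
          rw [revealTranscript_congr A hK.le hR.le hG hb ω h]
        simp only [g, h']
      · simp only [g, κ] at h ⊢
        rw [chain_congr h, revealTranscript_congr A hK.le hR.le hG hb ω
          fun j hj => h j (by omega)]

end ChainLoss


/-! ### Geometric decay along the chain -/

theorem exp_neg_le_one_sub {s : ℝ} (hs0 : 0 ≤ s) (hs : s ≤ 7 / 8) : Real.exp (-(8 * s)) ≤ 1 - s := by
  rw [Real.exp_neg]
  have h := Real.add_one_le_exp (8 * s)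
  refine inv_le_of_inv_le₀ (by linarith) (le_trans ?_ h)
  rw [inv_le_iff_one_le_mul₀ (by linarith)]
  -- (1 + 8s)(1 - s) ≥ 1 exactly for 0 ≤ s ≤ 7/8.
  nlinarith

/-- The constant of the lower bound for exact gradients. -/
def chainConst : ℝ := Real.exp (-32) / 96

theorem chainConst_pos : 0 < chainConst := by unfold chainConst; positivity

theorem chainConst_le : chainConst ≤ 1 / 96 := by
  unfold chainConst
  have : Real.exp (-32) ≤ 1 := Real.exp_le_one_iff.2 (by norm_num)
  linarith

/-- With y geometric, the multipliers τ and the thresholds c are geometric as well, up to the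
constant that makes τ N = 0. The thresholds exceed the jumps √2 G / K because s²H/λ = 3/2 > √2. -/
theorem hardInstance_exp {H lam Δ Lstar r : ℝ} {T b : ℕ} (hb : 1 ≤ b) (hlam : 0 < lam)
    (hH : 2 * lam ≤ H) (hΔ : 0 < Δ) (hL : 0 ≤ Lstar) (hr : 0 ≤ r) (hr2 : 2 * Δ ≤ lam * r ^ 2) :
    ∃ err, chainConst * (Δ * Real.exp (-(20 * (√lam * T / √H)))) ≤ err ∧
      HardInstance H lam Lstar Δ r err T b := by
  have hH0 : 0 < H := by linarith
  set s : ℝ := √(3 / 2 * lam / H) with hs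
  have hs0 : 0 < s := Real.sqrt_pos.2 (by positivity)
  have hs2 : s ^ 2 = 3 / 2 * lam / H := Real.sq_sqrt (by positivity)
  have hs2H : s ^ 2 * H = 3 / 2 * lam := by rw [hs2]; field_simp
  have hs78 : s ≤ 7 / 8 := by
    refine Real.sqrt_le_iff.2 ⟨by norm_num, ?_⟩
    rw [div_le_iff₀ hH0]
    linarith
  have hslam : s ≤ 5 / 4 * (√lam / √H) := by
    rw [← Real.sqrt_div hlam.le, hs]
    refine Real.sqrt_le_iff.2 ⟨by positivity, ?_⟩
    rw [mul_pow, Real.sq_sqrt (by positivity), mul_div_assoc]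
    have : 0 ≤ lam / H := by positivity
    linarith
  set q : ℝ := 1 - s with hq
  have hq0 : 0 < q := by linarith
  have hq1 : q ≤ 1 := by linarith
  set a : ℝ := √(Δ / (H * s)) with ha
  have ha0 : 0 < a := Real.sqrt_pos.2 (by positivity)
  have ha2 : a ^ 2 * (H * s) = Δ := by
    rw [ha, Real.sq_sqrt (by positivity)]; field_simp
  -- About 1/s links remain hidden: enough for them to carry a constant share of the error, while
  -- q^m stays bounded below.
  set m : ℕ := ⌈1 / s⌉₊ with hm
  have hm1 : 1 ≤ s * m := by
    have := Nat.le_ceil (1 / s)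
    rw [div_le_iff₀ hs0] at this
    linarith
  have hm2 : s * m ≤ 2 := by
    have := (Nat.ceil_lt_add_one (by positivity : 0 ≤ 1 / s)).le
    have h2 := mul_le_mul_of_nonneg_left this hs0.le
    have h3 : s * (1 / s + 1) = 1 + s := by field_simp
    linarith
  have hm0 : 0 < m := by
    rcases Nat.eq_zero_or_pos m with h | h
    · rw [h] at hm1; norm_num at hm1
    · exact h
  set N : ℕ := T + m with hN
  set K : ℝ := H - lam with hK
  have hK0 : 0 < K := by linarith
  have hqj : ∀ j, 0 < q ^ j := fun j => pow_pos hq0 j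
  have hqN : ∀ j ≤ N, q ^ N ≤ q ^ j := fun j hj => pow_le_pow_of_le_one hq0.le hq1 hj
  -- G is τ without its negative constant, by Kλ/H = (2/3)Ks². Against thresholds a s q^(j+1), the
  -- jumps take at most 29/30 and 2δ at most 1/50.
  refine ⟨_, ?_, hardInstance_chain (N := N) (H := H) (K := K) (lam := lam)
    (G := fun j => 2 / 3 * a * K * q * s * q ^ j) (c := fun j => a * q ^ j - a * q ^ (j + 1))
    (y := fun j => a * q ^ j)
    (τ := fun j => K * lam / H * (a * q ^ (j + 1) - a * q ^ (N + 1)) / s)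
    (δ := a * q ^ N * s / 100) hb (by omega) hlam (by linarith) (by linarith) hL
    (fun j => by have := hqj j; positivity) (fun j => by have := hqj j; positivity) ?_
    (fun j => rfl) (by have := hqj N; positivity) ?_ ?_ ?_ ?_ ?_ ?_ ?_ hr hr2⟩
  · have hNT : ((N : ℕ) : ℝ) - T = m := by rw [hN]; push_cast; ring
    rw [hNT]
    have e1 : lam / 2 * (m * (a * q ^ N / 4) ^ 2) / 2 = (s * m) * (Δ * (q ^ N) ^ 2) / 96 := by
      rw [← ha2]
      linear_combination (-(m : ℝ) * a ^ 2 * (q ^ N) ^ 2 / 96) * hs2H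
    rw [e1, chainConst]
    have h1 : Real.exp (-(8 * s * N)) ≤ q ^ N := by
      rw [show -(8 * s * N) = (N : ℝ) * (-(8 * s)) by ring, Real.exp_nat_mul]
      exact pow_le_pow_left₀ (Real.exp_pos _).le (exp_neg_le_one_sub hs0.le hs78) N
    have h2 : Real.exp (-(16 * s * N)) ≤ (q ^ N) ^ 2 := by
      rw [show -(16 * s * N) = ((2 : ℕ) : ℝ) * (-(8 * s * N)) by push_cast; ring,
        Real.exp_nat_mul]
      exact pow_le_pow_left₀ (Real.exp_pos _).le h1 2
    -- Since N = T + m, 16sT ≤ 20 √(λ/H) T and 16sm ≤ 32.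
    have h3 : Real.exp (-32) * Real.exp (-(20 * (√lam * T / √H))) ≤ Real.exp (-(16 * s * N)) := by
      rw [← Real.exp_add]
      refine Real.exp_le_exp.2 ?_
      have hT : (0 : ℝ) ≤ T := Nat.cast_nonneg T
      have h4 := mul_le_mul_of_nonneg_right hslam hT
      have h5 : √lam * T / √H = √lam / √H * T := by ring
      rw [h5, hN]
      push_cast
      linarith
    have h4 := mul_le_mul_of_nonneg_left (h3.trans h2) hΔ.le
    have h5 : 0 ≤ Δ * (q ^ N) ^ 2 := by positivity
    have h6 := mul_le_mul_of_nonneg_right hm1 h5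
    linarith
  · intro i j hij
    exact mul_le_mul_of_nonneg_left (pow_le_pow_of_le_one hq0.le hq1 hij) ha0.le
  · have := hqj N
    have h : a * q ^ N * s ≤ a * q ^ N * 1 := mul_le_mul_of_nonneg_left (by linarith) (by positivity)
    have : 0 < a * q ^ N := by positivity
    linarith
  · intro j hj
    have h1 := mul_le_mul_of_nonneg_left (hqN (j + 1) hj.le) (by positivity : 0 ≤ a * s)
    have h2 : √2 ≤ 29 / 20 := Real.sqrt_le_iff.2 ⟨by norm_num, by norm_num⟩
    have h3 : √2 * (2 / 3 * a * K * q * s * q ^ j) / K = √2 * (2 / 3 * (a * s * q ^ (j + 1))) := by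
      field_simp
      ring
    have h4 : 0 < a * s * q ^ (j + 1) := by have := hqj (j + 1); positivity
    have h5 : a * q ^ (j + 1) - a * q ^ (j + 1 + 1) = a * s * q ^ (j + 1) := by
      rw [pow_succ q (j + 1), hq]; ring
    have h6 := mul_le_mul_of_nonneg_right h2 (by positivity : 0 ≤ 2 / 3 * (a * s * q ^ (j + 1)))
    rw [h3, h5]
    linarith
  · intro j hj
    have := mul_le_mul_of_nonneg_left (pow_le_pow_of_le_one hq0.le hq1
      (show j + 1 ≤ N + 1 by omega)) ha0.le
    exact div_nonneg (mul_nonneg (by positivity) (by linarith)) hs0.le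
  · intro j _
    have h1 : K * lam / H = 2 / 3 * K * s ^ 2 := by rw [hs2]; field_simp
    have h2 : 0 < a * q ^ (N + 1) := by have := hqj (N + 1); positivity
    rw [h1, div_le_iff₀ hs0]
    have h3 : 0 ≤ 2 / 3 * K * s ^ 2 * (a * q ^ (N + 1)) := by positivity
    have h4 : 2 / 3 * a * K * q * s * q ^ j * s = 2 / 3 * K * s ^ 2 * (a * q ^ (j + 1)) := by
      rw [pow_succ]; ring
    rw [h4]
    linarith
  · simp
  · intro j _
    rw [← sub_div, div_eq_iff hs0.ne', pow_succ q (j + 1), hq]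
    ring
  · have h1 : q ^ 2 ≤ 1 := pow_le_one₀ hq0.le hq1
    have h2 : K * q ^ 2 ≤ H * 1 := mul_le_mul (by linarith) h1 (by positivity) hH0.le
    have h3 := mul_le_mul_of_nonneg_left h2 (by positivity : 0 ≤ a ^ 2 * s)
    have h4 : 2 / 3 * a * K * q * s * q ^ 0 * (a * q ^ 1) = 2 / 3 * (a ^ 2 * s * (K * q ^ 2)) := by
      ring
    rw [h4]
    linarith

end MinibatchLB

end

/-! ### Choice of the instance for the largest term -/

theorem corollary1 :
    (∃ c : ℝ, 0 < c ∧
      ∀ (H B Lstar : ℝ) (T b : ℕ), 0 < H → 0 < B → 0 ≤ Lstar → 1 ≤ T → 1 ≤ b →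
        Lstar ≤ H * B ^ 2 * (b * T) →
        ∃ (d : ℕ) (Z : Type) (_ : MeasurableSpace Z) (l : MinibatchLB.E d → Z → ℝ),
          MinibatchLB.MeasurableLoss l ∧
          ∀ (Ω : Type) [MeasurableSpace Ω] (P : Measure Ω) [IsProbabilityMeasure P]
            (A : MinibatchLB.Algorithm d T Ω),
            ∃ D : Measure Z, IsProbabilityMeasure D ∧
              (∀ w, Integrable (l w) D) ∧
              MinibatchLB.SmoothConvexLoss l D H ∧
              MinibatchLB.ConvexAssumption (MinibatchLB.expLoss l D) Lstar B ∧
              ENNReal.ofReal (c * (H * B ^ 2 / (T : ℝ) ^ 2 + H * B ^ 2 / (b * T)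
                  + Real.sqrt (H * B ^ 2 * Lstar / (b * T))))
                ≤ A.expectedError P b l D Lstar) ∧
    (∃ c c' : ℝ, 0 < c ∧ 0 < c' ∧
      ∀ (H lam Δ Lstar : ℝ) (T b : ℕ), 0 < lam → 2 * lam ≤ H → 0 < Δ → 0 ≤ Lstar →
        1 ≤ T → 1 ≤ b →
        ∃ (d : ℕ) (Z : Type) (_ : MeasurableSpace Z) (l : MinibatchLB.E d → Z → ℝ),
          MinibatchLB.MeasurableLoss l ∧
          ∀ (Ω : Type) [MeasurableSpace Ω] (P : Measure Ω) [IsProbabilityMeasure P]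
            (A : MinibatchLB.Algorithm d T Ω),
            ∃ D : Measure Z, IsProbabilityMeasure D ∧
              (∀ w, Integrable (l w) D) ∧
              MinibatchLB.SmoothConvexLoss l D H ∧
              MinibatchLB.GrowthAssumption (MinibatchLB.expLoss l D) Lstar Δ lam ∧
              StrongConvexOn Set.univ lam (MinibatchLB.expLoss l D) ∧
              ENNReal.ofReal (c * (Δ * Real.exp (-(c' * (Real.sqrt lam * T / Real.sqrt H)))
                  + Δ * (if (b : ℝ) * T ≤ H / (2 * lam) then 1 else 0)
                  + min (H * Lstar / (lam * (b * T))) Δ))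
                ≤ A.expectedError P b l D Lstar) := by
  set c₀ := MinibatchLB.chainConst with hc₀
  have hc₀0 : 0 < c₀ := MinibatchLB.chainConst_pos
  have hc₀1 : c₀ ≤ 1 / 96 := MinibatchLB.chainConst_le
  refine ⟨⟨c₀ * Real.exp (-20) / 12, by positivity, ?_⟩,
    ⟨c₀ / 3, 20, by positivity, by norm_num, ?_⟩⟩
  · intro H B Lstar T b hH hB hL hT hb hLB
    have hT1 : (1 : ℝ) ≤ T := by exact_mod_cast hT
    have hb1 : (1 : ℝ) ≤ b := by exact_mod_cast hb
    have hT0 : (0 : ℝ) < T := by linarith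
    have hb0 : (0 : ℝ) < b := by linarith
    have hexp : Real.exp (-20) ≤ 1 := Real.exp_le_one_iff.2 (by norm_num)
    have hc₁ : c₀ * Real.exp (-20) / 4 ≤ 1 / 32 := by nlinarith [Real.exp_pos (-20)]
    have hX2 : 0 < H * B ^ 2 / (b * T) := by positivity
    set X1 := H * B ^ 2 / (T : ℝ) ^ 2 with hX1
    set X3 := Real.sqrt (H * B ^ 2 * Lstar / (b * T)) with hX3
    have key : ∀ X, X1 ≤ X → H * B ^ 2 / (b * T) ≤ X → X3 ≤ X →
        c₀ * Real.exp (-20) / 12 * (X1 + H * B ^ 2 / (b * T) + X3) ≤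
          c₀ * Real.exp (-20) / 4 * X := by
      intro X h1 h2 h3
      have : 0 ≤ c₀ * Real.exp (-20) / 12 := by positivity
      nlinarith
    by_cases h1 : H * B ^ 2 / (b * T) ≤ X1 ∧ X3 ≤ X1
    · have hTT : (T : ℝ) ≤ T ^ 2 := by nlinarith
      -- With λ = H/(2T²) the exponent 20 √(λ/H) T is at most 20, and Δ is as large as 2Δ ≤ λB²
      -- permits.
      obtain ⟨err, herr, h⟩ := MinibatchLB.hardInstance_exp (H := H) (lam := H / (2 * T ^ 2))
        (Δ := H * B ^ 2 / (4 * T ^ 2)) (Lstar := Lstar) (r := B) (T := T) hb (by positivity)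
        (by rw [mul_div_assoc', div_le_iff₀ (by positivity)]; nlinarith) (by positivity) hL hB.le
        (le_of_eq (by field_simp; ring))
      refine h.convex (by positivity) le_rfl ((key X1 le_rfl h1.1 h1.2).trans (le_trans ?_ herr))
      have hle : √(H / (2 * T ^ 2)) * T / √H ≤ 1 := by
        rw [div_le_one (Real.sqrt_pos.2 hH)]
        have e : √(H / (2 * T ^ 2)) * T = √(H / 2) := by
          rw [← div_div, Real.sqrt_div (by positivity), Real.sqrt_sq hT0.le,
            div_mul_cancel₀ _ hT0.ne']
        rw [e]
        exact Real.sqrt_le_sqrt (by linarith)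
      have hexp' : Real.exp (-20) ≤ Real.exp (-(20 * (√(H / (2 * T ^ 2)) * T / √H))) :=
        Real.exp_le_exp.2 (by linarith)
      have e1 : c₀ * Real.exp (-20) / 4 * X1 =
          c₀ * (H * B ^ 2 / (4 * T ^ 2) * Real.exp (-20)) := by
        rw [hX1]; field_simp
      rw [e1]
      gcongr
    by_cases h2 : X1 ≤ H * B ^ 2 / (b * T) ∧ X3 ≤ H * B ^ 2 / (b * T)
    · have hp1 : 1 / (2 * (b * T)) ≤ (1 : ℝ) := by
        rw [div_le_one (by positivity)]; nlinarith
      refine (MinibatchLB.hardInstance_twoPoint (H := H) (p := 1 / (2 * (b * T))) (ε := 1)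
        (A := B) (Lstar := Lstar) (T := T) (b := b) hH (by positivity) hp1 one_pos le_rfl
        (le_of_eq (by field_simp)) (by simpa using hL)).convex (by positivity)
        (by rw [one_mul, abs_of_pos hB]) ((key _ h2.1 le_rfl h2.2).trans ?_)
      have e1 : 1 / (2 * (b * T)) * H * B ^ 2 * 1 ^ 2 / 16 = 1 / 32 * (H * B ^ 2 / (b * T)) := by
        field_simp; norm_num
      rw [e1]
      exact mul_le_mul_of_nonneg_right hc₁ hX2.le
    have h3 : X1 ≤ X3 ∧ H * B ^ 2 / (b * T) ≤ X3 := by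
      by_contra hcon
      rcases le_total X1 X3 with h | h <;> rcases le_total (H * B ^ 2 / (b * T)) X3 with h' | h' <;>
        rcases le_total X1 (H * B ^ 2 / (b * T)) with h'' | h'' <;>
        first
          | exact hcon ⟨h, h'⟩
          | exact h1 ⟨by linarith, by linarith⟩
          | exact h2 ⟨by linarith, by linarith⟩
    -- With ε² = 1/(2p bT) and A = B/ε the minimizers have norm B and pHA²/2 = p²HB² bT. Equating
    -- this to L* fixes p, and the upper bound on L* gives p ≤ 1.
    set p : ℝ := √(Lstar / (H * B ^ 2 * (b * T))) with hp
    have hden : 0 < H * B ^ 2 * (b * T) := by positivity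
    have hpX : p * (H * B ^ 2) = X3 := by
      rw [hp, hX3, ← Real.sqrt_sq (by positivity : 0 ≤ H * B ^ 2), ← Real.sqrt_mul (by positivity)]
      congr 1
      rw [Real.sqrt_sq (by positivity)]
      field_simp
    have hp2 : p ^ 2 * (H * B ^ 2 * (b * T)) = Lstar := by
      rw [hp, Real.sq_sqrt (by positivity)]; field_simp
    have hp1 : p ≤ 1 := Real.sqrt_le_one.2 ((div_le_one hden).2 hLB)
    have hpn : 1 ≤ p * (b * T) := by
      have := h3.2
      rw [← hpX, div_le_iff₀ (by positivity)] at this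
      have h0 : 0 < H * B ^ 2 := by positivity
      refine le_of_mul_le_mul_left ?_ h0
      linarith
    have hp0 : 0 < p := by
      by_contra hcon
      push Not at hcon
      have := mul_nonpos_of_nonpos_of_nonneg hcon (by positivity : (0 : ℝ) ≤ b * T)
      linarith
    set ε : ℝ := √(1 / (2 * (p * (b * T)))) with hε
    have hε0 : 0 < ε := Real.sqrt_pos.2 (by positivity)
    have hε2 : ε ^ 2 * (2 * (p * (b * T))) = 1 := by
      rw [hε, Real.sq_sqrt (by positivity)]; field_simp
    have hε1 : ε ≤ 1 := Real.sqrt_le_one.2 ((div_le_one (by positivity)).2 (by linarith))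
    have hA : B / ε * ε = B := div_mul_cancel₀ _ hε0.ne'
    refine (MinibatchLB.hardInstance_twoPoint (H := H) (p := p) (ε := ε) (A := B / ε)
        (Lstar := Lstar) (T := T) (b := b) hH hp0 hp1 hε0 hε1 (by linarith) ?_).convex
        (by positivity) (by rw [abs_of_pos (by positivity), mul_comm, hA])
        ((key _ h3.1 h3.2 le_rfl).trans ?_)
    · have hA2 : (B / ε) ^ 2 = B ^ 2 * (2 * (p * (b * T))) := by
        rw [div_pow, div_eq_iff (by positivity)]
        linear_combination (-B ^ 2) * hε2
      have e1 : p * H / 2 * (B / ε) ^ 2 = Lstar := by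
        rw [hA2, ← hp2]; ring
      rw [e1]
      have : 0 ≤ Lstar * ε ^ 2 := by positivity
      linarith
    · have e1 : p * H * (B / ε) ^ 2 * ε ^ 2 / 16 = 1 / 16 * X3 := by
        rw [← hpX]
        linear_combination (p * H / 16 * (B / ε * ε + B)) * hA
      rw [e1]
      exact mul_le_mul_of_nonneg_right (by linarith) (Real.sqrt_nonneg _)
  · intro H lam Δ Lstar T b hlam hH hΔ hL hT hb
    have hT0 : (0 : ℝ) < T := by exact_mod_cast hT
    have hb0 : (0 : ℝ) < b := by exact_mod_cast hb
    have hH0 : 0 < H := by linarith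
    set Y1 := Δ * Real.exp (-(20 * (Real.sqrt lam * T / Real.sqrt H))) with hY1
    set Y3 := min (H * Lstar / (lam * (b * T))) Δ with hY3
    have hY3Δ : Y3 ≤ Δ := min_le_right _ _
    have hY30 : 0 ≤ Y3 := le_min (by positivity) hΔ.le
    have hY1Δ : Y1 ≤ Δ := mul_le_of_le_one_right hΔ.le
      (Real.exp_le_one_iff.2 (by have : 0 ≤ Real.sqrt lam * T / Real.sqrt H := by positivity
                                 linarith))
    have hpH : lam / H * H = lam := div_mul_cancel₀ _ hH0.ne'
    have hp1 : lam / H ≤ 1 := (div_le_one hH0).2 (by linarith)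
    split_ifs with hn
    -- Here p = λ/H, so the curvature pH is λ. As p bT ≤ 1/2, ε = 1 is allowed, and the error Δ/8
    -- covers all three terms.
    · have hA2 : √(2 * Δ / lam) ^ 2 = 2 * Δ / lam := Real.sq_sqrt (by positivity)
      have hlA : lam * (2 * Δ / lam) = 2 * Δ := by field_simp
      have h := MinibatchLB.hardInstance_twoPoint (H := H) (p := lam / H) (ε := 1)
        (A := √(2 * Δ / lam)) (Lstar := Lstar) (T := T) (b := b) hH0 (by positivity) hp1 one_pos
        le_rfl (by
          rw [one_pow, mul_one, div_mul_eq_mul_div, div_le_iff₀ hH0]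
          rw [le_div_iff₀ (by positivity)] at hn
          linarith) (by simpa using hL)
      rw [hpH, hA2] at h
      refine h.stronglyConvex hlam.le (by linarith) ?_
      have : c₀ / 3 * (Y1 + Δ * 1 + Y3) ≤ c₀ / 3 * (3 * Δ) :=
        mul_le_mul_of_nonneg_left (by linarith) (by positivity)
      nlinarith
    · push Not at hn
      rcases le_total Y3 Y1 with hY | hY
      · obtain ⟨err, herr, h⟩ := MinibatchLB.hardInstance_exp (H := H) (lam := lam) (Δ := Δ)
          (Lstar := Lstar) (r := √(2 * Δ / lam)) (T := T) hb hlam hH hΔ hL (Real.sqrt_nonneg _)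
          (le_of_eq (by rw [Real.sq_sqrt (by positivity)]; field_simp))
        refine h.stronglyConvex hlam.le le_rfl (le_trans ?_ herr)
        nlinarith
      · set p : ℝ := lam / H with hp
        have hp0 : 0 < p := by positivity
        have hpn : 1 ≤ 2 * (p * (b * T)) := by
          rw [div_lt_iff₀ (by positivity)] at hn
          rw [hp, div_mul_eq_mul_div, mul_div_assoc', le_div_iff₀ hH0]
          linarith
        set ε : ℝ := √(1 / (2 * (p * (b * T)))) with hε
        have hε0 : 0 < ε := Real.sqrt_pos.2 (by positivity)
        have hε2 : ε ^ 2 * (2 * (p * (b * T))) = 1 := by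
          rw [hε, Real.sq_sqrt (by positivity)]; field_simp
        have hε1 : ε ≤ 1 := Real.sqrt_le_one.2 ((div_le_one (by positivity)).2 hpn)
        -- M bounds the variance level λA²/2: the first entry keeps it below L*, and the second
        -- keeps the initial gap Mε² below Δ.
        set M : ℝ := min Lstar (Δ / ε ^ 2) with hM
        have hM0 : 0 ≤ M := le_min hL (by positivity)
        have hA2 : √(2 * M / lam) ^ 2 = 2 * M / lam := Real.sq_sqrt (by positivity)
        have hlA : lam * (2 * M / lam) = 2 * M := by field_simp
        have hMΔ : M * ε ^ 2 ≤ Δ := by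
          rw [← le_div_iff₀ (by positivity)]; exact min_le_right _ _
        have hMY : 1 / 2 * Y3 ≤ M * ε ^ 2 := by
          rw [hM, min_mul_of_nonneg _ _ (by positivity)]
          refine le_min ?_ ?_
          · have e1 : H * Lstar / (lam * (b * T)) = 2 * (Lstar * ε ^ 2) := by
              rw [hε, Real.sq_sqrt (by positivity), hp]; field_simp
            have := min_le_left (H * Lstar / (lam * (b * T))) Δ
            linarith
          · rw [div_mul_cancel₀ _ (by positivity)]
            linarith
        have h := MinibatchLB.hardInstance_twoPoint (H := H) (p := p) (ε := ε)
          (A := √(2 * M / lam)) (Lstar := Lstar) (T := T) (b := b) hH0 hp0 hp1 hε0 hε1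
          (by linarith) (by
            rw [hpH, hA2]
            have h1 : M ≤ Lstar := min_le_left _ _
            have h2 : 0 ≤ M * ε ^ 2 := by positivity
            have e : lam / 2 * (2 * M / lam) * (1 - ε ^ 2) = M * (1 - ε ^ 2) := by field_simp
            rw [e]
            linarith)
        rw [hpH, hA2, hlA] at h
        have e : lam / 2 * (2 * M / lam) * ε ^ 2 = M * ε ^ 2 := by field_simp
        rw [e] at h
        refine h.stronglyConvex hlam.le hMΔ ?_
        have h1 : c₀ / 3 * (Y1 + Δ * 0 + Y3) ≤ c₀ / 3 * (2 * Y3) :=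
          mul_le_mul_of_nonneg_left (by linarith) (by positivity)
        nlinarith
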